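/- Let $n\ge 2$. For $\sigma\in\mathbb S_n$ write $c(\sigma)_i=\sigma(i)$, and let $\ell(\sigma)_i=\#\{j>i:\ c(\sigma)_j<c(\sigma)_i\}$ $(1\le i\le n)$ be its Lehmer code. The Lehmer register stores the digit $\ell(\sigma)_i\in\{0,\dots,n-i\}$ in binary in $\lceil\log_2(n-i+1)\rceil$ qubits. Let $\tau_s=(s\ \,s+1)$, and put $\pi_t=\tau_{t-1}\cdots\tau_2\tau_1$ and $\tilde\pi_t=\tau_t\tau_{t+1}\cdots\tau_{n-1}$ for $1\le t\le n$. A circuit implements the reordering unitary $U_\pi$ if it maps $|\ell(\sigma)\rangle\mapsto|\ell(\sigma\pi)\rangle$ for all $\sigma\in\mathbb S_n$; $U_s$ denotes $U_{\tau_s}$. Circuits consist of arbitrary one-qubit unitaries and CNOT gates and use no ancillary qubits; the depth is the number of layers of gates acting on disjoint qubits. There is an absolute constant $C>0$ such that for every $n\ge 2$ there are circuits $V_1,\dots,V_{n-1}$ on the Lehmer register such that $V_s$ acts only on the qubits of the digits $s$ and $s+1$, implements $U_s$, and has depth at most $Cn\log n$; and the following hold. 1. (Partial assignments.) Let $k\ge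 1$ and let $i_1,\dots,i_k\in\{1,\dots,n\}$ be distinct. There are $t_1,\dots,t_k$ such that $\pi=\pi_{t_1}\cdots\pi_{t_k}$ satisfies $\pi(k+1-l)=i_l$ for $l=1,\dots,k$ (so the indices are brought to the positions $k,k-1,\dots,1$), the resulting product expression of $\pi$ has at most $kn$ factors $\tau_s$, and the concatenation of the corresponding circuits $V_s$ implements $U_\pi$ and has depth at most $C\,k\,n^2\log n$. Moreover, for all $j_1,\dots,j_k\in\{1,\dots,n\}$, if $\varphi(\sigma)\in\{0,1\}$ indicates whether $c(\sigma)_{i_l}=j_l$ for all $l$, then there is a circuit of depth at most $C\,k^2\log^2 n$, acting only on the qubits of the first $k$ digits and one output qubit, that maps $|\ell(\sigma\pi)\rangle|b\rangle\mapsto|\ell(\sigma\pi)\rangle|b\oplus\varphi(\sigma)\rangle$ for all $\sigma\in\mathbb S_n$, $b\in\{0,1\}$. 2. (Partial rankings.) Let $k\ge 0$ and let $i_1,\dots,i_{k+1}\in\{1,\dots,n\}$ be distinct. There are $t_1,\dots,t_{k+1}$ such that $\pi=\tilde\pi_{t_1}\cdots\tilde\pi_{t_{k+1}}$ satisfies $\pi(n-k-1+l)=i_l$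 for $l=1,\dots,k+1$ (so the indices are brought to the positions $n-k,\dots,n$), the resulting product expression of $\pi$ has at most $(k+1)n$ factors $\tau_s$, and the concatenation of the corresponding circuits $V_s$ implements $U_\pi$. If $k\ge 1$, this concatenation has depth at most $C\,k\,n^2\log n$, and, if $\varphi(\sigma)\in\{0,1\}$ indicates whether $c(\sigma)_{i_1}>c(\sigma)_{i_2}>\dots>c(\sigma)_{i_{k+1}}$, there is a circuit of depth at most $C\,k^2\log^2 n$, acting only on the qubits of the last $k+1$ digits and one output qubit, that maps $|\ell(\sigma\pi)\rangle|b\rangle\mapsto|\ell(\sigma\pi)\rangle|b\oplus\varphi(\sigma)\rangle$ for all $\sigma\in\mathbb S_n$, $b\in\{0,1\}$. -/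

import Mathlib

noncomputable section

/-! Quantum circuits over the basic gates: all one-qubit unitaries and CNOT. -/

/-- A basic gate on qubits labelled by `W`: an arbitrary one-qubit unitary applied to qubit `q`, or
a controlled NOT with control `c` and target `t`. -/
inductive Gate (W : Type) : Type
  | single (q : W) (U : Matrix.unitaryGroup Bool ℂ) : Gate W
  | cnot (c t : W) (hct : c ≠ t) : Gate W

/-- The qubits on which a gate acts. -/
def Gate.wires {W : Type} : Gate W → Set W
  | .single q _ => {q}
  | .cnot c t _ => {c, t}

/-- The matrix of a gate in the computational basis (bit strings `W → Bool`): rows are indexed by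
output strings `x`, columns by input strings `y`. -/
def Gate.mat {W : Type} [Fintype W] [DecidableEq W] :
    Gate W → Matrix (W → Bool) (W → Bool) ℂ
  | .single q U => Matrix.of fun x y =>
      if ∀ w, w ≠ q → x w = y w then (U : Matrix Bool Bool ℂ) (x q) (y q) else 0
  | .cnot c t _ => Matrix.of fun x y =>
      if x = Function.update y t (xor (y t) (y c)) then 1 else 0

/-- A layer (one time step): gates acting on pairwise disjoint sets of qubits. -/
structure Layer (W : Type) where
  gates : List (Gate W)
  disjoint : gates.Pairwise fun g h => Disjoint g.wires h.wires

/-- The matrix of a layer; the factors commute. -/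
def Layer.mat {W : Type} [Fintype W] [DecidableEq W] (L : Layer W) :
    Matrix (W → Bool) (W → Bool) ℂ :=
  (L.gates.map Gate.mat).prod

/-- A circuit is a sequence of layers, the head of the list being applied first. Its only qubits
are those in `W`: there are no ancillas besides. -/
abbrev Circuit (W : Type) : Type := List (Layer W)

/-- The depth of a circuit is its number of layers. -/
def Circuit.depth {W : Type} (c : Circuit W) : ℕ := c.length

/-- The matrix of a circuit (the first layer is the rightmost factor). -/
def Circuit.mat {W : Type} [Fintype W] [DecidableEq W] (c : Circuit W) :
    Matrix (W → Bool) (W → Bool) ℂ :=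
  (c.reverse.map Layer.mat).prod

/-- All gates of the circuit act inside the set `S` of qubits. -/
def Circuit.ActsOn {W : Type} (c : Circuit W) (S : Set W) : Prop :=
  ∀ L ∈ c, ∀ g ∈ L.gates, g.wires ⊆ S

/-- The computational basis vector `|x⟩`. -/
def ket {W : Type} [DecidableEq W] [Fintype W] (x : W → Bool) : (W → Bool) → ℂ :=
  Pi.single x 1

/-! The Lehmer encoding. Positions and objects are numbered from `0`, so that the `i`-th digit of
the Lehmer code lies in `{0, …, n - 1 - i}`; the Cauchy encoding of `σ` is `i ↦ σ i`. -/

/-- The `i`-th digit of the Lehmer code of `σ`. -/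
def lehmer {n : ℕ} (σ : Equiv.Perm (Fin n)) (i : Fin n) : ℕ :=
  (Finset.univ.filter fun j : Fin n => i < j ∧ σ j < σ i).card

/-- The qubits of the Lehmer register: the `i`-th digit, which has `n - i` possible values, is
stored in `⌈log₂ (n - i)⌉` qubits. -/
abbrev LehmerWire (n : ℕ) : Type := Σ i : Fin n, Fin (Nat.clog 2 (n - (i : ℕ)))

/-- The bit string `ℓ(σ)`: the binary expansions of the digits of the Lehmer code. -/
def lehmerBits {n : ℕ} (σ : Equiv.Perm (Fin n)) : LehmerWire n → Bool :=
  fun w => (lehmer σ w.1).testBit (w.2 : ℕ)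

/-- The circuit implements the reordering unitary `U_π`, that is
`|ℓ(σ)⟩ ↦ |ℓ(σπ)⟩` for all permutations `σ`. -/
def ImplementsReorder {n : ℕ} (c : Circuit (LehmerWire n)) (π : Equiv.Perm (Fin n)) : Prop :=
  ∀ σ : Equiv.Perm (Fin n),
    (Circuit.mat c).mulVec (ket (lehmerBits σ)) = ket (lehmerBits (σ * π))

/-! Adjacent transpositions and the cycles moving one entry to the beginning or to the end. -/

/-- The adjacent transposition of the positions `s` and `s + 1`. -/
def adjSwap {n : ℕ} (s : Fin (n - 1)) : Equiv.Perm (Fin n) :=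
  Equiv.swap ⟨s, by omega⟩ ⟨s + 1, by omega⟩

/-- The word `s₁, s₂, …` of adjacent transpositions stands for `τ_{s₁} τ_{s₂} ⋯`. -/
def wordPerm {n : ℕ} (w : List (Fin (n - 1))) : Equiv.Perm (Fin n) :=
  (w.map adjSwap).prod

/-- The word `τ_{t-1} ⋯ τ_1 τ_0` of the cycle that brings the entry in position `t` to the
beginning and shifts the entries before it by one place. -/
def frontWord {n : ℕ} (t : Fin n) : List (Fin (n - 1)) :=
  (List.ofFn fun s : Fin (t : ℕ) => (⟨s, by omega⟩ : Fin (n - 1))).reverse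

/-- The word `τ_t τ_{t+1} ⋯ τ_{n-2}` of the cycle that brings the entry in position `t` to the
end and shifts the entries after it by one place. -/
def backWord {n : ℕ} (t : Fin n) : List (Fin (n - 1)) :=
  List.ofFn fun s : Fin (n - 1 - (t : ℕ)) => (⟨t + s, by omega⟩ : Fin (n - 1))

/-- The concatenation of the circuits `V s`, `s` running through the word `w` in order. -/
def wordCircuit {n : ℕ} (V : Fin (n - 1) → Circuit (LehmerWire n)) (w : List (Fin (n - 1))) :
    Circuit (LehmerWire n) :=
  (w.map V).flatten

/-! Constraints and the computation of their consistency predicate. -/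

/-- Consistency with the order-`k` partial assignment `c(σ)_{i_l} = j_l` for all `l`. -/
def PartialAssignment {n k : ℕ} (i : Fin k ↪ Fin n) (j : Fin k → Fin n)
    (σ : Equiv.Perm (Fin n)) : Prop :=
  ∀ l : Fin k, σ (i l) = j l

/-- Consistency with the order-`k` partial ranking
`c(σ)_{i_1} > c(σ)_{i_2} > ⋯ > c(σ)_{i_{k+1}}`. -/
def PartialRanking {n k : ℕ} (i : Fin (k + 1) ↪ Fin n) (σ : Equiv.Perm (Fin n)) : Prop :=
  ∀ l : Fin k, σ (i l.succ) < σ (i l.castSucc)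

/-- The basis string with `x` in the register and `b` in the additional output qubit `none`. -/
def withOutput {W : Type} (x : W → Bool) (b : Bool) : Option W → Bool :=
  fun o => o.elim b x

open Classical in
/-- On the register reordered by `π`, the circuit computes the predicate `φ` of `σ` into the output
qubit: `|ℓ(σπ)⟩|b⟩ ↦ |ℓ(σπ)⟩|b ⊕ φ(σ)⟩`. -/
def ComputesAfterReorder {n : ℕ} (c : Circuit (Option (LehmerWire n)))
    (π : Equiv.Perm (Fin n)) (φ : Equiv.Perm (Fin n) → Prop) : Prop :=
  ∀ (σ : Equiv.Perm (Fin n)) (b : Bool),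
    (Circuit.mat c).mulVec (ket (withOutput (lehmerBits (σ * π)) b)) =
      ket (withOutput (lehmerBits (σ * π)) (xor b (decide (φ σ))))

end

/-!
Right multiplication by `τ_s` changes only the digits `s` and `s + 1` of the Lehmer code, by
`(a, b) ↦ (b, a - 1)` if `b < a` and `(a, b) ↦ (b + 1, a)` otherwise. Replacing `b` by `b + 1`
when `a ≤ b` turns the two digits into the ranks of the two entries among the values that are
still free, and in terms of ranks the map is a plain swap. The correction is computed bit by bit;
each bit costs `O(log n)` multi-controlled NOTs, which keeps the depth polylogarithmic.

The only difficulty is to do without ancillas. The group commutator of two controlled gates is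
controlled by the union of their controls, so a rotation controlled by `m` qubits reduces to NOTs
controlled by half of them, for which the other half serve as borrowed, dirty ancillas. This gives
multi-controlled rotations in linear depth and multi-controlled phases, hence multi-controlled
NOTs, in quadratic depth.

After the reordering, the first `k` digits determine the first `k` values, and a prescribed order
of the last `k + 1` values means that the last `k + 1` digits are all maximal. Each predicate thus
compares some of the digits with constants, and is a single multi-controlled NOT.
-/

noncomputable section

/-! ### Circuits of bounded depth -/

section Circuits

variable {W : Type} [DecidableEq W]

/-- The inverse gate. -/
def Gate.inv {W : Type} : Gate W → Gate W
  | .single q U => .single q U⁻¹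
  | .cnot c t hct => .cnot c t hct

theorem Gate.wires_inv {W : Type} (g : Gate W) : g.inv.wires = g.wires := by
  cases g <;> rfl

/-- The layer of the inverse gates. -/
def Layer.inv {W : Type} (L : Layer W) : Layer W where
  gates := (L.gates.map Gate.inv).reverse
  disjoint := by
    simpa only [List.pairwise_reverse, List.pairwise_map, Gate.wires_inv, disjoint_comm]
      using L.disjoint

/-- The circuit of the inverse layers in reverse order. -/
def Circuit.inv {W : Type} (c : Circuit W) : Circuit W := (c.map Layer.inv).reverse

theorem Circuit.ActsOn.inv {W : Type} {c : Circuit W} {R : Set W} (h : c.ActsOn R) :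
    c.inv.ActsOn R := by
  intro L hL g hg
  obtain ⟨L, hLc, rfl⟩ := List.mem_map.1 (List.mem_reverse.1 hL)
  obtain ⟨g, hgL, rfl⟩ := List.mem_map.1 (List.mem_reverse.1 hg)
  exact g.wires_inv.subset.trans (h L hLc g hgL)

/-- The matrix mapping `|x⟩` to `|f x⟩`. -/
def mapMat {W : Type} [Fintype W] (f : (W → Bool) → (W → Bool)) :
    Matrix (W → Bool) (W → Bool) ℂ :=
  Matrix.of fun x y => if x = f y then 1 else 0

theorem mapMat_id {W : Type} [Fintype W] : mapMat (id : (W → Bool) → (W → Bool)) = 1 := by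
  ext x y
  simp [mapMat, Matrix.one_apply]

/-- Negate qubit `t` under the condition `P`. -/
def condNot (t : W) (P : (W → Bool) → Bool) (x : W → Bool) : W → Bool :=
  Function.update x t ((x t ^^ P x))

theorem condNot_self (t : W) (P : (W → Bool) → Bool) (x : W → Bool) :
    condNot t P x t = (x t ^^ P x) := Function.update_self ..

theorem condNot_of_ne {t w : W} (h : w ≠ t) (P : (W → Bool) → Bool) (x : W → Bool) :
    condNot t P x w = x w := Function.update_of_ne h ..

theorem condNot_condNot {t : W} {P : (W → Bool) → Bool}
    (hP : ∀ x b, P (Function.update x t b) = P x) (x : W → Bool) :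
    condNot t P (condNot t P x) = x := by
  simp [condNot, hP]

variable [Fintype W]

theorem Circuit.mat_append (c d : Circuit W) : (c ++ d).mat = d.mat * c.mat := by
  simp [Circuit.mat]

theorem matrix_ext_ket {M N : Matrix (W → Bool) (W → Bool) ℂ}
    (h : ∀ x, M.mulVec (ket x) = N.mulVec (ket x)) : M = N :=
  Matrix.ext_of_mulVec_single h

theorem mapMat_mulVec_ket (f : (W → Bool) → (W → Bool)) (x : W → Bool) :
    (mapMat f).mulVec (ket x) = ket (f x) := by
  ext y
  simp [mapMat, ket, Matrix.col, Pi.single_apply]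

theorem mapMat_mul (f g : (W → Bool) → (W → Bool)) :
    mapMat f * mapMat g = mapMat (f ∘ g) :=
  matrix_ext_ket fun x => by simp [← Matrix.mulVec_mulVec, mapMat_mulVec_ket]

theorem diagonal_mulVec_ket (d : (W → Bool) → ℂ) (x : W → Bool) :
    (Matrix.diagonal d).mulVec (ket x) = d x • ket x := by
  ext y
  by_cases h : y = x <;> simp [ket, Matrix.mulVec_diagonal, h]

/-- The matrix applying the one-qubit matrix `F x` to qubit `t` of the basis vector `|x⟩`. -/
def block (t : W) (F : (W → Bool) → Matrix Bool Bool ℂ) : Matrix (W → Bool) (W → Bool) ℂ :=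
  Matrix.of fun x y => if ∀ w, w ≠ t → x w = y w then F y (x t) (y t) else 0

theorem block_mulVec_ket (t : W) (F : (W → Bool) → Matrix Bool Bool ℂ) (x : W → Bool) :
    (block t F).mulVec (ket x) = ∑ b, F x b (x t) • ket (Function.update x t b) := by
  ext y
  have eq_update_iff : ∀ b, y = Function.update x t b ↔ (∀ w, w ≠ t → y w = x w) ∧ y t = b :=
    fun b => by rw [Function.eq_update_iff, and_comm]
  simp only [ket, Matrix.mulVec_single_one, Matrix.col_apply, block, Matrix.of_apply,
    Finset.sum_apply, Pi.smul_apply, Pi.single_apply, eq_update_iff, smul_eq_mul]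
  by_cases h : ∀ w, w ≠ t → y w = x w
  · cases y t <;> simp
  · simp [h]

theorem block_mul (t : W) {F : (W → Bool) → Matrix Bool Bool ℂ}
    (hF : ∀ x b, F (Function.update x t b) = F x) (G : (W → Bool) → Matrix Bool Bool ℂ) :
    block t F * block t G = block t fun x => F x * G x := by
  refine matrix_ext_ket fun x => ?_
  rw [← Matrix.mulVec_mulVec, block_mulVec_ket, block_mulVec_ket]
  simp only [Fintype.sum_bool, Matrix.mulVec_add, Matrix.mulVec_smul, block_mulVec_ket, hF,
    Function.update_self, Function.update_idem, Matrix.mul_apply, smul_add, add_smul, smul_smul]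
  simp only [mul_comm]
  abel

theorem block_one (t : W) : block t (fun _ => 1) = 1 := by
  refine matrix_ext_ket fun x => ?_
  rw [block_mulVec_ket, Matrix.one_mulVec]
  cases hx : x t <;> simp [Matrix.one_apply, ← hx]

theorem Gate.mat_inv (g : Gate W) : g.inv.mat = g.mat⁻¹ := by
  refine (Matrix.inv_eq_left_inv ?_).symm
  cases g with
  | single q U =>
    calc block q (fun _ => ((U⁻¹ : Matrix.unitaryGroup Bool ℂ) : Matrix Bool Bool ℂ)) *
          block q (fun _ => (U : Matrix Bool Bool ℂ))
        = block q fun _ => ((U⁻¹ * U : Matrix.unitaryGroup Bool ℂ) : Matrix Bool Bool ℂ) :=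
          block_mul q (fun _ _ => rfl) _
      _ = 1 := by rw [inv_mul_cancel]; exact block_one q
  | cnot c t hct =>
    calc mapMat (condNot t fun x => x c) * mapMat (condNot t fun x => x c)
        = mapMat (condNot t (fun x => x c) ∘ condNot t fun x => x c) := mapMat_mul _ _
      _ = mapMat id := congrArg mapMat <| funext <|
          condNot_condNot fun x b => Function.update_of_ne hct b x
      _ = 1 := mapMat_id

theorem Layer.mat_inv (L : Layer W) : L.inv.mat = L.mat⁻¹ := by
  simp only [Layer.mat, Layer.inv, Matrix.list_prod_inv_reverse, List.map_reverse, List.map_map]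
  congr 3
  exact funext Gate.mat_inv

theorem Circuit.mat_inv (c : Circuit W) : c.inv.mat = c.mat⁻¹ := by
  simp only [Circuit.mat, Circuit.inv, Matrix.list_prod_inv_reverse, List.map_reverse,
    List.reverse_reverse, List.map_map]
  congr 2
  exact funext Layer.mat_inv

/-- The matrix `M` is realized on the qubits in `R` by a circuit of depth at most `d`. -/
def Realizes (R : Set W) (d : ℕ) (M : Matrix (W → Bool) (W → Bool) ℂ) : Prop :=
  ∃ c : Circuit W, c.ActsOn R ∧ c.depth ≤ d ∧ c.mat = M

namespace Realizes

variable {R : Set W} {d e : ℕ} {M N : Matrix (W → Bool) (W → Bool) ℂ}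

theorem mono (h : Realizes R d M) (hde : d ≤ e) : Realizes R e M := by
  obtain ⟨c, hcR, hcd, hcM⟩ := h
  exact ⟨c, hcR, hcd.trans hde, hcM⟩

theorem one (R : Set W) : Realizes R 0 1 :=
  ⟨[], by simp [Circuit.ActsOn], by simp [Circuit.depth], by simp [Circuit.mat]⟩

theorem mul (hM : Realizes R d M) (hN : Realizes R e N) : Realizes R (d + e) (M * N) := by
  obtain ⟨c, hcR, hcd, rfl⟩ := hM
  obtain ⟨c', hcR', hcd', rfl⟩ := hN
  refine ⟨c' ++ c, fun L hL => ?_, ?_, Circuit.mat_append c' c⟩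
  · exact (List.mem_append.1 hL).elim (hcR' L) (hcR L)
  · simp only [Circuit.depth, List.length_append] at *
    omega

theorem inv (h : Realizes R d M) : Realizes R d M⁻¹ := by
  obtain ⟨c, hcR, hcd, rfl⟩ := h
  exact ⟨c.inv, hcR.inv, by simpa [Circuit.depth, Circuit.inv] using hcd, c.mat_inv⟩

theorem gate (g : Gate W) (hg : g.wires ⊆ R) : Realizes R 1 g.mat :=
  ⟨[⟨[g], List.pairwise_singleton _ _⟩], by simpa [Circuit.ActsOn] using hg, le_rfl,
    by simp [Circuit.mat, Layer.mat]⟩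

theorem single {t : W} (ht : t ∈ R) {U : Matrix Bool Bool ℂ}
    (hU : U ∈ Matrix.unitaryGroup Bool ℂ) : Realizes R 1 (block t fun _ => U) :=
  gate (.single t ⟨U, hU⟩) (Set.singleton_subset_iff.2 ht)

end Realizes

/-- The map `|x⟩ ↦ |f x⟩` is realized on the qubits in `R` by a circuit of depth at most `d`. -/
def Computes (R : Set W) (d : ℕ) (f : (W → Bool) → (W → Bool)) : Prop :=
  Realizes R d (mapMat f)

/-- The matrix of the NOT gate. -/
def notMat : Matrix Bool Bool ℂ := Matrix.of fun a b => if a = b then 0 else 1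

theorem notMat_mem_unitaryGroup : notMat ∈ Matrix.unitaryGroup Bool ℂ := by
  rw [Matrix.mem_unitaryGroup_iff]
  ext a b
  cases a <;> cases b <;> simp [notMat, Matrix.mul_apply, Matrix.star_apply]

theorem mapMat_condNot (t : W) (P : (W → Bool) → Bool) :
    mapMat (condNot t P) = block t fun x => if P x then notMat else 1 := by
  refine matrix_ext_ket fun x => ?_
  rw [mapMat_mulVec_ket, block_mulVec_ket]
  cases hP : P x <;> cases hx : x t <;>
    simp [condNot, hP, hx, notMat, Matrix.one_apply]

namespace Computes

variable {R : Set W} {d e : ℕ} {f g : (W → Bool) → (W → Bool)}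

theorem mono (h : Computes R d f) (hde : d ≤ e) : Computes R e f :=
  Realizes.mono h hde

theorem id (R : Set W) : Computes R 0 (fun x : W → Bool => x) := by
  have h := Realizes.one R
  rwa [← mapMat_id] at h

theorem comp (hf : Computes R d f) (hg : Computes R e g) :
    Computes R (d + e) (fun x => f (g x)) := by
  have h := Realizes.mul hf hg
  rwa [mapMat_mul] at h

theorem of_leftInverse (hf : Computes R d f) (hgf : Function.LeftInverse g f) :
    Computes R d g := by
  have h : (mapMat f)⁻¹ = mapMat g :=
    Matrix.inv_eq_left_inv (by rw [mapMat_mul, hgf.comp_eq_id, mapMat_id])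
  rw [Computes, ← h]
  exact Realizes.inv hf

theorem cnot {c t : W} (hct : c ≠ t) (hc : c ∈ R) (ht : t ∈ R) :
    Computes R 1 (condNot t fun x => x c) :=
  Realizes.gate (.cnot c t hct) (Set.pair_subset hc ht)

theorem not {t : W} (ht : t ∈ R) : Computes R 1 (condNot t fun _ => true) := by
  rw [Computes, mapMat_condNot]
  exact Realizes.single ht notMat_mem_unitaryGroup

end Computes

end Circuits

/-! ### Multi-controlled NOT gates without ancillas -/

section Cube

variable {W : Type}

open Classical in
/-- The indicator function of the subcube on which the qubits in `S` carry the values `v`. -/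
def cube (S : Finset W) (v x : W → Bool) : Bool := decide (∀ w ∈ S, x w = v w)

theorem cube_eq_true {S : Finset W} {v x : W → Bool} :
    cube S v x = true ↔ ∀ w ∈ S, x w = v w := decide_eq_true_iff

theorem cube_empty (v : W → Bool) : cube ∅ v = fun _ => true := by
  ext x
  simp [cube]

theorem cube_singleton_top (c : W) : cube {c} ⊤ = fun x => x c := by
  ext x
  rw [Bool.eq_iff_iff]
  simp [cube_eq_true]

theorem cube_congr {S : Finset W} {v x y : W → Bool} (h : ∀ w ∈ S, x w = y w) :
    cube S v x = cube S v y := by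
  rw [Bool.eq_iff_iff, cube_eq_true, cube_eq_true]
  exact forall₂_congr fun w hw => by rw [h w hw]

variable [DecidableEq W]

theorem cube_insert (c : W) (S : Finset W) (v x : W → Bool) :
    cube (insert c S) v x = ((x c == v c) && cube S v x) := by
  rw [Bool.eq_iff_iff]
  simp [cube_eq_true]

theorem cube_union (A B : Finset W) (v x : W → Bool) :
    cube (A ∪ B) v x = (cube A v x && cube B v x) := by
  rw [Bool.eq_iff_iff]
  simp [cube_eq_true, or_imp, forall_and]

theorem cube_update {S : Finset W} {t : W} (ht : t ∉ S) (v x : W → Bool) (b : Bool) :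
    cube S v (Function.update x t b) = cube S v x :=
  cube_congr fun _ hw => Function.update_of_ne (ne_of_mem_of_not_mem hw ht) ..

end Cube

section ControlledPhase

variable {W : Type} [DecidableEq W] [Fintype W]

theorem exists_norm_one_pow_eq {z : ℂ} (hz : ‖z‖ = 1) {m : ℕ} (hm : 0 < m) :
    ∃ w : ℂ, ‖w‖ = 1 ∧ w ^ m = z := by
  obtain ⟨w, rfl⟩ := IsAlgClosed.exists_pow_nat_eq z hm
  rw [norm_pow] at hz
  exact ⟨w, (pow_eq_one_iff_of_nonneg (norm_nonneg _) hm.ne').1 hz, rfl⟩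

/-- The one-qubit gate `diag(u, v)`. -/
def diagMat (u v : ℂ) : Matrix Bool Bool ℂ := Matrix.diagonal fun b => if b then v else u

theorem diagMat_mem_unitaryGroup {u v : ℂ} (hu : ‖u‖ = 1) (hv : ‖v‖ = 1) :
    diagMat u v ∈ Matrix.unitaryGroup Bool ℂ := by
  rw [Matrix.mem_unitaryGroup_iff, diagMat, Matrix.star_eq_conjTranspose,
    Matrix.diagonal_conjTranspose, Matrix.diagonal_mul_diagonal, ← Matrix.diagonal_one]
  congr 1
  funext b
  cases b <;> simp [Complex.mul_conj, Complex.normSq_eq_norm_sq, hu, hv]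

theorem diagMat_one_one : diagMat 1 1 = 1 := by
  simp [diagMat]

/-- The rotation `diag(w⁻¹, w)` of qubit `t`, controlled by the qubits in `S`. -/
def ctrlRot {W : Type} [Fintype W] (S : Finset W) (t : W) (w : ℂ) :
    Matrix (W → Bool) (W → Bool) ℂ :=
  Matrix.diagonal fun x => if cube S ⊤ x then (if x t then w else w⁻¹) else 1

/-- The phase `z` on the strings in which all qubits of `S` are set. -/
def ctrlPhase {W : Type} [Fintype W] (S : Finset W) (z : ℂ) :
    Matrix (W → Bool) (W → Bool) ℂ :=
  Matrix.diagonal fun x => if cube S ⊤ x then z else 1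

variable {R : Set W} {t : W} {d : ℕ}

theorem block_diagMat (t : W) (u v : (W → Bool) → ℂ) :
    (block t fun x => diagMat (u x) (v x)) =
      Matrix.diagonal fun x => if x t then v x else u x := by
  refine matrix_ext_ket fun x => ?_
  rw [block_mulVec_ket, diagonal_mulVec_ket]
  cases hx : x t <;> simp [diagMat, ← hx]

theorem ctrlPhase_insert (S : Finset W) (t : W) {w : ℂ} (hw : w ≠ 0) :
    ctrlPhase (insert t S) (w ^ 2) = ctrlRot S t w * ctrlPhase S w := by
  rw [ctrlPhase, ctrlRot, ctrlPhase, Matrix.diagonal_mul_diagonal]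
  congr 1
  funext x
  rw [cube_insert]
  cases cube S ⊤ x <;> cases x t <;> simp [hw, sq]

theorem Realizes.rot (ht : t ∈ R) {v : ℂ} (hv : ‖v‖ = 1) :
    Realizes R 1 (Matrix.diagonal fun x : W → Bool => if x t then v else v⁻¹) := by
  have h := Realizes.single ht (diagMat_mem_unitaryGroup (u := v⁻¹) (v := v) (by simp [hv]) hv)
  rwa [block_diagMat] at h

theorem Realizes.ctrlPhase_singleton (ht : t ∈ R) {z : ℂ} (hz : ‖z‖ = 1) :
    Realizes R 1 (ctrlPhase {t} z) := by
  have h := Realizes.single ht (diagMat_mem_unitaryGroup (u := 1) (v := z) (by simp) hz)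
  rw [block_diagMat] at h
  simpa [ctrlPhase, cube_singleton_top] using h

/-- The group commutator of a controlled NOT and a rotation `diag(v⁻¹, v)` is a controlled rotation;
interleaving two sets of controls yields the rotation controlled by their union. -/
theorem Realizes.ctrlRot_union {A B : Finset W} {e : ℕ} (ht : t ∈ R) (hA : t ∉ A) (hB : t ∉ B)
    (hdA : Computes R d (condNot t (cube A ⊤))) (heB : Computes R e (condNot t (cube B ⊤)))
    {w : ℂ} (hw : ‖w‖ = 1) :
    Realizes R (2 * d + 2 * e + 4) (ctrlRot (A ∪ B) t w) := by
  obtain ⟨v, hv, rfl⟩ := exists_norm_one_pow_eq hw (m := 4) (by norm_num)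
  have hv0 : v ≠ 0 := norm_ne_zero_iff.1 (by simp [hv])
  have h1 := Realizes.rot ht hv
  have h2 := Realizes.rot ht (v := v⁻¹) (by simp [hv])
  have h := ((((((hdA.mul h2).mul heB).mul h1).mul hdA).mul h2).mul heB).mul h1
  convert h.mono (e := 2 * d + 2 * e + 4) (by omega) using 1
  refine matrix_ext_ket fun x => ?_
  simp only [← Matrix.mulVec_mulVec, diagonal_mulVec_ket, mapMat_mulVec_ket, Matrix.mulVec_smul,
    smul_smul, ctrlRot, cube_union]
  have update_eq : ∀ b, x t = b → Function.update x t b = x := by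
    rintro b rfl
    exact Function.update_eq_self _ _
  simp only [condNot, cube_update hA, cube_update hB, Function.update_self, Function.update_idem]
  cases cube A ⊤ x <;> cases cube B ⊤ x <;> cases hx : x t <;>
    simp [hv0, update_eq _ hx] <;> field_simp

end ControlledPhase

section Hadamard

/-- The Hadamard gate. -/
def hadMat : Matrix Bool Bool ℂ :=
  (((Real.sqrt 2)⁻¹ : ℝ) : ℂ) • Matrix.of fun a b => if a && b then -1 else 1

theorem inv_sqrt_two_mul_self :
    (((Real.sqrt 2)⁻¹ : ℝ) : ℂ) * (((Real.sqrt 2)⁻¹ : ℝ) : ℂ) = 1 / 2 := by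
  rw [← Complex.ofReal_mul, ← mul_inv, Real.mul_self_sqrt (by norm_num)]
  norm_num

theorem hadMat_mul_self : hadMat * hadMat = 1 := by
  have h := inv_sqrt_two_mul_self
  ext a b
  cases a <;> cases b <;>
    simp only [hadMat, Matrix.smul_mul, Matrix.mul_smul, smul_smul, h] <;>
    norm_num [Matrix.mul_apply]

theorem hadMat_mem_unitaryGroup : hadMat ∈ Matrix.unitaryGroup Bool ℂ := by
  have star_eq : star hadMat = hadMat := by
    ext a b
    cases a <;> cases b <;> simp [hadMat, Matrix.star_apply]
  rw [Matrix.mem_unitaryGroup_iff, star_eq, hadMat_mul_self]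

theorem hadMat_mul_diagMat_mul_hadMat : hadMat * (diagMat 1 (-1) * hadMat) = notMat := by
  have h := inv_sqrt_two_mul_self
  ext a b
  cases a <;> cases b <;>
    simp only [hadMat, Matrix.smul_mul, Matrix.mul_smul, smul_smul, h] <;>
    simp [Matrix.mul_apply, diagMat, notMat, Matrix.diagonal_apply] <;> norm_num

end Hadamard

section ControlledNot

variable {W : Type} [DecidableEq W] [Fintype W] {R : Set W} {S : Finset W} {t : W} {d : ℕ}

/-- Conjugation by Hadamard gates turns the phase `-1` into a NOT gate. -/
theorem Computes.condNot_cube_of_ctrlPhase (ht : t ∈ R) (hS : t ∉ S)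
    (h : Realizes R d (ctrlPhase (insert t S) (-1))) :
    Computes R (d + 2) (condNot t (cube S ⊤)) := by
  have hH := Realizes.single ht hadMat_mem_unitaryGroup
  have phase_eq : ctrlPhase (insert t S) (-1) =
      block t fun x => diagMat 1 (if cube S ⊤ x then -1 else 1) := by
    rw [block_diagMat, ctrlPhase]
    congr 1
    funext x
    rw [cube_insert]
    cases cube S ⊤ x <;> cases x t <;> simp
  have conj_eq : mapMat (condNot t (cube S ⊤)) =
      block t (fun _ => hadMat) * (ctrlPhase (insert t S) (-1) * block t fun _ => hadMat) := by
    rw [phase_eq, block_mul t (fun x b => by rw [cube_update hS]), block_mul t (fun _ _ => rfl),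
      mapMat_condNot]
    congr 1
    funext x
    cases cube S ⊤ x <;> simp [diagMat_one_one, hadMat_mul_self, hadMat_mul_diagMat_mul_hadMat]
  rw [Computes, conj_eq]
  exact (hH.mul (h.mul hH)).mono (by omega)

theorem Computes.toffoli {a b : W} (hab : a ≠ b) (hat : a ≠ t) (hbt : b ≠ t)
    (ha : a ∈ R) (hb : b ∈ R) (ht : t ∈ R) :
    Computes R 19 (condNot t fun x => x a && x b) := by
  have cnot_cube {c t : W} (hct : c ≠ t) (hc : c ∈ R) (ht : t ∈ R) :
      Computes R 1 (condNot t (cube {c} ⊤)) :=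
    cube_singleton_top c ▸ Computes.cnot hct hc ht
  have not_cube : Computes R 1 (condNot a (cube ∅ ⊤)) := cube_empty (W := W) ⊤ ▸ Computes.not ha
  obtain ⟨w, hw, hw2⟩ := exists_norm_one_pow_eq (z := -1) (by simp) (m := 2) (by norm_num)
  obtain ⟨v, hv, rfl⟩ := exists_norm_one_pow_eq hw (m := 2) (by norm_num)
  have hv0 : v ≠ 0 := norm_ne_zero_iff.1 (by simp [hv])
  have rot_t : Realizes R 8 (ctrlRot ({a} ∪ {b}) t (v ^ 2)) :=
    Realizes.ctrlRot_union ht (by simpa using hat.symm) (by simpa using hbt.symm)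
      (cnot_cube hat ha ht) (cnot_cube hbt hb ht) hw
  have rot_a : Realizes R 8 (ctrlRot ({b} ∪ ∅) a v) :=
    Realizes.ctrlRot_union ha (by simpa using hab) (by simp)
      (cnot_cube hab.symm hb ha) not_cube hv
  have phase : Realizes R 17 (ctrlPhase (insert t {a, b}) (-1)) := by
    rw [← hw2, ctrlPhase_insert _ _ (pow_ne_zero 2 hv0), ctrlPhase_insert _ _ hv0]
    exact rot_t.mul (rot_a.mul (Realizes.ctrlPhase_singleton hb hv))
  convert Computes.condNot_cube_of_ctrlPhase ht (by simp [hat.symm, hbt.symm]) phase using 2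
  ext x
  rw [cube_insert, cube_singleton_top, Pi.top_apply, top_eq_true, beq_true]

end ControlledNot

section Ladder

variable {W : Type} [DecidableEq W]

/-- The action `f` of a ladder of Toffoli gates: it adds the conjunction of the qubits in `A` to the
qubit `t`, at the price of modifying the dirty ancillas in `B` on the way. -/
structure IsLadder (A B : Finset W) (t : W) (f : (W → Bool) → (W → Bool)) : Prop where
  involutive : Function.Involutive f
  target : ∀ x, f x t = (x t ^^ cube A ⊤ x)
  of_notMem : ∀ x w, w ≠ t → w ∉ B → f x w = x w
  update : ∀ x u b, u ≠ t → u ∉ A → u ∉ B → f (Function.update x u b) = Function.update (f x) u b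

namespace IsLadder

theorem singleton {c t : W} (hct : c ≠ t) (B : Finset W) :
    IsLadder {c} B t (condNot t fun x => x c) where
  involutive := condNot_condNot fun x b => Function.update_of_ne hct b x
  target x := by simp [condNot_self, cube_singleton_top]
  of_notMem x w hw _ := condNot_of_ne hw _ x
  update x u b hut huc _ := by
    have hcu : c ≠ u := fun h => huc (Finset.mem_singleton.2 h.symm)
    rw [condNot, condNot, Function.update_of_ne hut.symm, Function.update_of_ne hcu,
      Function.update_comm hut.symm]

variable {A B : Finset W} {a c t : W} {g : (W → Bool) → (W → Bool)}

theorem toffoli_conj_apply (hg : IsLadder A (B.erase a) a g) (hca : c ≠ a) (hcB : c ∉ B)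
    (hct : c ≠ t) (hta : t ≠ a) (htA : t ∉ A) (htB : t ∉ B) (x : W → Bool) :
    condNot t (fun y => y c && y a) (g (condNot t (fun y => y c && y a) x)) =
      Function.update (g x) t (x t ^^ cube (insert c A) ⊤ x) := by
  have notMem_erase {w : W} (hw : w ∉ B) : w ∉ B.erase a := mt Finset.mem_of_mem_erase hw
  have hgc : g x c = x c := hg.of_notMem x c hca (notMem_erase hcB)
  simp only [condNot, hg.update _ _ _ hta htA (notMem_erase htB), Function.update_self,
    Function.update_idem, Function.update_of_ne hct, Function.update_of_ne hta.symm, hgc,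
    hg.target, cube_update htA, cube_insert]
  cases x c <;> cases x a <;> cases cube A ⊤ x <;> simp

theorem insert (hg : IsLadder A (B.erase a) a g) (ha : a ∈ B) (hca : c ≠ a) (hcB : c ∉ B)
    (hct : c ≠ t) (hta : t ≠ a) (htA : t ∉ A) (htB : t ∉ B) :
    IsLadder (insert c A) B t
      (fun x => condNot t (fun y => y c && y a) (g (condNot t (fun y => y c && y a) x))) := by
  have notMem_erase {w : W} (hw : w ∉ B) : w ∉ B.erase a := mt Finset.mem_of_mem_erase hw
  have conj_apply := hg.toffoli_conj_apply hca hcB hct hta htA htB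
  refine ⟨fun x => ?_, fun x => ?_, fun x w hwt hwB => ?_, fun x u b hut hu huB => ?_⟩
  · have toffoli_toffoli := condNot_condNot (t := t) (P := fun y => y c && y a) fun x b => by
      rw [Function.update_of_ne hct, Function.update_of_ne hta.symm]
    simp only [toffoli_toffoli, hg.involutive _]
  · rw [conj_apply, Function.update_self]
  · rw [conj_apply, Function.update_of_ne hwt,
      hg.of_notMem x w (ne_of_mem_of_not_mem ha hwB).symm (notMem_erase hwB)]
  · have huA : u ∉ A := mt (Finset.mem_insert_of_mem (b := c)) hu
    rw [conj_apply, conj_apply, cube_update hu, Function.update_of_ne hut.symm,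
      hg.update x u b (ne_of_mem_of_not_mem ha huB).symm huA (notMem_erase huB),
      Function.update_comm hut.symm]

theorem toffoli_conj_comp_self (hg : IsLadder A (B.erase a) a g) (hca : c ≠ a) (hcB : c ∉ B)
    (hct : c ≠ t) (hta : t ≠ a) (htA : t ∉ A) (htB : t ∉ B) (hAB : Disjoint A B) (haA : a ∉ A) :
    (fun x => condNot t (fun y => y c && y a) (g (condNot t (fun y => y c && y a) (g x)))) =
      condNot t (cube (Insert.insert c A) ⊤) := by
  have hgw {x w} (hwa : w ≠ a) (hw : w ∉ B) : g x w = x w :=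
    hg.of_notMem x w hwa (mt Finset.mem_of_mem_erase hw)
  have cube_apply (x) : cube (Insert.insert c A) ⊤ (g x) = cube (Insert.insert c A) ⊤ x := by
    refine cube_congr fun w hw => ?_
    obtain rfl | hwA := Finset.mem_insert.1 hw
    exacts [hgw hca hcB, hgw (ne_of_mem_of_not_mem hwA haA) (Finset.disjoint_left.1 hAB hwA)]
  ext1 x
  rw [hg.toffoli_conj_apply hca hcB hct hta htA htB, hg.involutive x, cube_apply, hgw hta htB,
    condNot]

end IsLadder

end Ladder

section LinearDepth

variable {W : Type} [DecidableEq W] [Fintype W] {R : Set W} {S A B : Finset W} {t : W}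

theorem exists_isLadder (hA : A.Nonempty) (hAR : ↑A ⊆ R) (hBR : ↑B ⊆ R) (ht : t ∈ R)
    (htA : t ∉ A) (htB : t ∉ B) (hAB : Disjoint A B) (hcard : A.card ≤ B.card + 1) :
    ∃ f, IsLadder A B t f ∧ Computes R (38 * A.card) f := by
  induction hA using Finset.Nonempty.cons_induction generalizing t B with
  | singleton c =>
    have hct : c ≠ t := by simpa [eq_comm] using htA
    exact ⟨_, .singleton hct B, (Computes.cnot hct (hAR (by simp)) ht).mono (by simp)⟩
  | cons c A hcA hne ih =>
    rw [Finset.card_cons] at hcard ⊢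
    simp only [Finset.cons_eq_insert, Finset.mem_insert, not_or, Finset.disjoint_insert_left,
      Finset.coe_insert, Set.insert_subset_iff] at *
    obtain ⟨a, ha⟩ : B.Nonempty := Finset.card_pos.1 (by have := hne.card_pos; omega)
    have haA : a ∉ A := Finset.disjoint_right.1 hAB.2 ha
    have hta : t ≠ a := (ne_of_mem_of_not_mem ha htB).symm
    have hca : c ≠ a := (ne_of_mem_of_not_mem ha hAB.1).symm
    obtain ⟨g, hg, hgR⟩ := ih (B := B.erase a) hAR.2
      ((Finset.coe_subset.2 (Finset.erase_subset _ _)).trans hBR) (hBR ha) haA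
      (Finset.notMem_erase _ _) (hAB.2.mono_right (Finset.erase_subset _ _))
      (by rw [Finset.card_erase_add_one ha]; omega)
    have hT := Computes.toffoli hca (Ne.symm htA.1) hta.symm hAR.1 (hBR ha) ht
    exact ⟨_, hg.insert ha hca hAB.1 (Ne.symm htA.1) hta htA.2 htB,
      (hT.comp (hgR.comp hT)).mono (by omega)⟩

theorem Computes.condNot_cube_of_dirty (hAR : ↑A ⊆ R) (hBR : ↑B ⊆ R) (ht : t ∈ R)
    (htA : t ∉ A) (htB : t ∉ B) (hAB : Disjoint A B) (hcard : A.card ≤ B.card + 1) :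
    Computes R (76 * A.card + 1) (condNot t (cube A ⊤)) := by
  rcases A.eq_empty_or_nonempty with rfl | hA
  · rw [cube_empty]
    exact Computes.not ht
  induction hA using Finset.Nonempty.cons_induction with
  | singleton c =>
    have hct : c ≠ t := by simpa [eq_comm] using htA
    rw [cube_singleton_top]
    exact (Computes.cnot hct (hAR (by simp)) ht).mono (by simp)
  | cons c A hcA hne _ =>
    rw [Finset.card_cons] at hcard ⊢
    simp only [Finset.cons_eq_insert, Finset.mem_insert, not_or, Finset.disjoint_insert_left,
      Finset.coe_insert, Set.insert_subset_iff] at *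
    obtain ⟨a, ha⟩ : B.Nonempty := Finset.card_pos.1 (by have := hne.card_pos; omega)
    have haA : a ∉ A := Finset.disjoint_right.1 hAB.2 ha
    have hta : t ≠ a := (ne_of_mem_of_not_mem ha htB).symm
    have hca : c ≠ a := (ne_of_mem_of_not_mem ha hAB.1).symm
    obtain ⟨g, hg, hgR⟩ := exists_isLadder (B := B.erase a) hne hAR.2
      ((Finset.coe_subset.2 (Finset.erase_subset _ _)).trans hBR) (hBR ha) haA
      (Finset.notMem_erase _ _) (hAB.2.mono_right (Finset.erase_subset _ _))
      (by rw [Finset.card_erase_add_one ha]; omega)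
    have hT := Computes.toffoli hca (Ne.symm htA.1) hta.symm hAR.1 (hBR ha) ht
    rw [← hg.toffoli_conj_comp_self hca hAB.1 (Ne.symm htA.1) hta htA.2 htB hAB.2 haA]
    exact (hT.comp (hgR.comp (hT.comp hgR))).mono (by omega)

/-- Each half of `S` serves as the dirty ancillas of the NOT gate controlled by the other half. -/
theorem Realizes.ctrlRot (hS : ↑S ⊆ R) (ht : t ∈ R) (htS : t ∉ S) {w : ℂ} (hw : ‖w‖ = 1) :
    Realizes R (152 * S.card + 8) (ctrlRot S t w) := by
  obtain ⟨A, hA, hcard⟩ := Finset.exists_subset_card_eq (s := S) (n := S.card / 2) (by omega)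
  have hcard_sdiff := Finset.card_sdiff_add_card_eq_card hA
  have hAR : ↑A ⊆ R := (Finset.coe_subset.2 hA).trans hS
  have hSAR : ↑(S \ A) ⊆ R := (Finset.coe_subset.2 Finset.sdiff_subset).trans hS
  have htA : t ∉ A := fun h => htS (hA h)
  have htSA : t ∉ S \ A := fun h => htS (Finset.sdiff_subset h)
  have h := Realizes.ctrlRot_union ht htA htSA
    (Computes.condNot_cube_of_dirty hAR hSAR ht htA htSA Finset.disjoint_sdiff (by omega))
    (Computes.condNot_cube_of_dirty hSAR hAR ht htSA htA Finset.sdiff_disjoint (by omega)) hw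
  rw [Finset.union_sdiff_of_subset hA] at h
  exact h.mono (by omega)

theorem Realizes.ctrlPhase (hne : S.Nonempty) (hS : ↑S ⊆ R) {z : ℂ} (hz : ‖z‖ = 1) :
    Realizes R (152 * S.card ^ 2) (ctrlPhase S z) := by
  induction hne using Finset.Nonempty.cons_induction generalizing z with
  | singleton c => exact (Realizes.ctrlPhase_singleton (hS (by simp)) hz).mono (by simp)
  | cons c S hc _ ih =>
    obtain ⟨w, hw, rfl⟩ := exists_norm_one_pow_eq hz (m := 2) (by norm_num)
    have hw0 : w ≠ 0 := norm_ne_zero_iff.1 (by simp [hw])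
    rw [Finset.coe_cons, Set.insert_subset_iff] at hS
    rw [Finset.cons_eq_insert, ctrlPhase_insert _ _ hw0, Finset.card_insert_of_notMem hc]
    exact ((Realizes.ctrlRot hS.2 hS.1 hc hw).mul (ih hS.2 hw)).mono (by ring_nf; omega)

theorem Computes.condNot_cube_top (hS : ↑S ⊆ R) (ht : t ∈ R) (htS : t ∉ S) :
    Computes R (154 * (S.card + 1) ^ 2) (condNot t (cube S ⊤)) := by
  have hinsert : ↑(insert t S) ⊆ R := by
    rw [Finset.coe_insert]
    exact Set.insert_subset ht hS
  have h := Realizes.ctrlPhase (z := -1) (Finset.insert_nonempty t S) hinsert (by simp)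
  refine (Computes.condNot_cube_of_ctrlPhase ht htS h).mono ?_
  rw [Finset.card_insert_of_notMem htS]
  ring_nf
  omega

theorem Computes.negate (v : W → Bool) (hS : ↑S ⊆ R) :
    Computes R S.card (fun x w => x w ^^ (decide (w ∈ S) && !v w)) := by
  induction S using Finset.induction_on with
  | empty => simpa using Computes.id R
  | insert c S hc ih =>
    rw [Finset.coe_insert, Set.insert_subset_iff] at hS
    have negate_c : Computes R 1 (condNot c fun _ => !v c) := by
      cases v c
      · exact Computes.not hS.1
      · convert (Computes.id R).mono zero_le_one using 1
        ext1 x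
        simp [condNot]
    rw [Finset.card_insert_of_notMem hc]
    convert (ih hS.2).comp negate_c using 1
    ext x w
    by_cases hw : w = c
    · simp [hw, hc, condNot_self]
    · simp [hw, condNot_of_ne]

theorem Computes.condNot_cube (v : W → Bool) (hS : ↑S ⊆ R) (ht : t ∈ R) (htS : t ∉ S) :
    Computes R (156 * (S.card + 1) ^ 2) (condNot t (cube S v)) := by
  have hneg := Computes.negate v hS
  have h := hneg.comp ((Computes.condNot_cube_top hS ht htS).comp hneg)
  convert h.mono (e := 156 * (S.card + 1) ^ 2) (by ring_nf; omega) using 1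
  ext x w
  have cube_negate : cube S ⊤ (fun w => x w ^^ (decide (w ∈ S) && !v w)) = cube S v x := by
    rw [Bool.eq_iff_iff, cube_eq_true, cube_eq_true]
    refine forall₂_congr fun w hw => ?_
    cases x w <;> cases v w <;> simp [hw]
  by_cases hw : w = t
  · simp [hw, htS, condNot_self, cube_negate]
  · simp [hw, condNot_of_ne]

end LinearDepth

/-! ### Controlled maps -/

section Ctrl

variable {W : Type}

/-- The map `f` controlled by the condition `P`. -/
def ctrl (P : (W → Bool) → Bool) (f : (W → Bool) → (W → Bool)) (x : W → Bool) : W → Bool :=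
  if P x then f x else x

variable {P Q : (W → Bool) → Bool} {f g : (W → Bool) → (W → Bool)} {x : W → Bool}

theorem ctrl_of_true (h : P x = true) : ctrl P f x = f x := if_pos h

theorem ctrl_of_false (h : P x = false) : ctrl P f x = x := by simp [ctrl, h]

theorem ctrl_ctrl (P Q : (W → Bool) → Bool) (f : (W → Bool) → (W → Bool)) :
    ctrl P (ctrl Q f) = ctrl (fun x => P x && Q x) f := by
  ext1 x
  cases hP : P x <;> cases hQ : Q x <;> simp [ctrl, hP, hQ]

theorem ctrl_id (P : (W → Bool) → Bool) : ctrl P (fun x => x) = fun x => x :=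
  funext fun _ => ite_self _

theorem ctrl_comp (hg : ∀ x, P (g x) = P x) :
    ctrl P (fun x => f (g x)) = fun x => ctrl P f (ctrl P g x) := by
  ext1 x
  cases hP : P x <;> simp [ctrl, hP, hg]

theorem ctrl_leftInverse (hPf : ∀ x, P (f x) = P x) (hgf : Function.LeftInverse g f) :
    Function.LeftInverse (ctrl P g) (ctrl P f) := fun x => by
  cases hP : P x <;> simp [ctrl, hP, hPf, hgf x]

theorem ctrl_condNot [DecidableEq W] (P : (W → Bool) → Bool) (t : W) (Q : (W → Bool) → Bool) :
    ctrl P (condNot t Q) = condNot t fun x => P x && Q x := by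
  ext1 x
  cases hP : P x <;> simp [ctrl, condNot, hP]

/-- The map `f` does not change the qubits outside `U`. -/
def FixesOff (U : Finset W) (f : (W → Bool) → (W → Bool)) : Prop :=
  ∀ x, ∀ w ∉ U, f x w = x w

theorem condNot_fixesOff [DecidableEq W] {U : Finset W} {t : W} (ht : t ∈ U)
    (P : (W → Bool) → Bool) : FixesOff U (condNot t P) := fun x _ hw =>
  condNot_of_ne (ne_of_mem_of_not_mem ht hw).symm P x

theorem FixesOff.mono {U V : Finset W} (hf : FixesOff U f) (hUV : U ⊆ V) : FixesOff V f :=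
  fun x w hw => hf x w (mt (@hUV w) hw)

theorem FixesOff.comp {U : Finset W} (hf : FixesOff U f) (hg : FixesOff U g) :
    FixesOff U fun x => f (g x) :=
  fun x w hw => (hf (g x) w hw).trans (hg x w hw)

theorem FixesOff.ctrl {U : Finset W} (hf : FixesOff U f) (P : (W → Bool) → Bool) :
    FixesOff U (ctrl P f) := fun x w hw => by
  cases hP : P x
  · rw [ctrl_of_false hP]
  · rw [ctrl_of_true hP, hf x w hw]

end Ctrl

section Control

variable {W : Type} [DecidableEq W] [Fintype W] {R : Set W} {U V : Finset W} {d e : ℕ}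
  {P : (W → Bool) → Bool} {f g : (W → Bool) → (W → Bool)}

/-- `P` is a condition independent of the qubits in `U`, and any qubit in `U` can be negated under
the conjunction of `P` and a prescription of values of other qubits in `U`, in depth `d`. -/
structure IsControl (R : Set W) (U : Finset W) (d : ℕ) (P : (W → Bool) → Bool) : Prop where
  indep : ∀ x y, (∀ w ∉ U, x w = y w) → P x = P y
  computes : ∀ t ∈ U, ∀ S ⊆ U, t ∉ S → ∀ v : W → Bool,
    Computes R d (ctrl P (condNot t (cube S v)))

theorem isControl_true (hU : ↑U ⊆ R) : IsControl R U (156 * U.card ^ 2) fun _ => true where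
  indep _ _ _ := rfl
  computes t ht S hS htS v := by
    have hcard : S.card + 1 ≤ U.card := by
      rw [← Finset.card_insert_of_notMem htS]
      exact Finset.card_le_card (Finset.insert_subset ht hS)
    exact (Computes.condNot_cube v ((Finset.coe_subset.2 hS).trans hU) (hU ht) htS).mono
      (by gcongr)

namespace IsControl

theorem mono (hP : IsControl R U d P) (hV : V ⊆ U) : IsControl R V d P where
  indep x y hxy := hP.indep x y fun w hw => hxy w (mt (@hV w) hw)
  computes t ht S hS := hP.computes t (hV ht) S (hS.trans hV)

theorem apply_eq (hP : IsControl R U d P) (hg : FixesOff U g) (x : W → Bool) : P (g x) = P x :=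
  hP.indep _ _ (hg x)

theorem ctrl_comp {a b : ℕ} (hP : IsControl R U d P) (hg : FixesOff U g)
    (hfR : Computes R a (ctrl P f)) (hgR : Computes R b (ctrl P g)) :
    Computes R (a + b) (ctrl P fun x => f (g x)) := by
  rw [_root_.ctrl_comp (hP.apply_eq hg)]
  exact hfR.comp hgR

theorem ctrl_of_leftInverse {a : ℕ} (hP : IsControl R U d P) (hf : FixesOff U f)
    (hfR : Computes R a (ctrl P f)) (hgf : Function.LeftInverse g f) :
    Computes R a (ctrl P g) :=
  hfR.of_leftInverse (ctrl_leftInverse (hP.apply_eq hf) hgf)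

theorem and_cube {T : Finset W} (hP : IsControl R U d P) (hT : T ⊆ U) (hV : V ⊆ U)
    (hTV : Disjoint T V) (v : W → Bool) : IsControl R V d fun x => P x && cube T v x where
  indep x y hxy := by
    rw [hP.indep x y fun w hw => hxy w (mt (@hV w) hw),
      cube_congr fun w hw => hxy w (Finset.disjoint_left.1 hTV hw)]
  computes t ht S hS htS u := by
    have htT : t ∉ T := Finset.disjoint_right.1 hTV ht
    convert hP.computes t (hV ht) (T ∪ S) (Finset.union_subset hT (hS.trans hV))
      (by simp [htT, htS]) (fun w => if w ∈ T then v w else u w) using 1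
    rw [← ctrl_ctrl, ctrl_condNot (cube T v)]
    congr 2
    ext x
    rw [Bool.eq_iff_iff, Bool.and_eq_true]
    simp only [cube_eq_true, Finset.mem_union, or_imp, forall_and]
    refine and_congr (forall₂_congr fun w hw => by simp [hw]) (forall₂_congr fun w hw => ?_)
    simp [Finset.disjoint_right.1 hTV (hS hw)]

/-- Adding `u` to `v` before and after makes the control `v`. -/
theorem and_beq {u v : W} (hP : IsControl R U d P) (huv : u ≠ v) (hv : v ∈ U)
    (huR : u ∈ R) (hvR : v ∈ R) (hV : V ⊆ U) (huV : u ∉ V) (hvV : v ∉ V) :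
    IsControl R V (d + 2) fun x => P x && (x u == x v) where
  indep x y hxy := by
    rw [hP.indep x y fun w hw => hxy w (mt (@hV w) hw), hxy u huV, hxy v hvV]
  computes t ht S hS htS val := by
    have hut : u ≠ t := (ne_of_mem_of_not_mem ht huV).symm
    have hvt : v ≠ t := (ne_of_mem_of_not_mem ht hvV).symm
    have hvS : v ∉ S := fun h => hvV (hS h)
    have hcnot := Computes.cnot huv huR hvR
    have hnot := hP.computes t (hV ht) (insert v S) (Finset.insert_subset hv (hS.trans hV))
      (by simp [hvt.symm, htS]) (Function.update val v false)
    convert (hcnot.comp (hnot.comp hcnot)).mono (e := d + 2) (by omega) using 1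
    have cond_eq (x : W → Bool) : (P (condNot v (fun x => x u) x) &&
        cube (insert v S) (Function.update val v false) (condNot v (fun x => x u) x)) =
        (P x && (x u == x v) && cube S val x) := by
      rw [hP.apply_eq (condNot_fixesOff hv _), Bool.and_assoc, cube_insert, condNot_self,
        Function.update_self]
      congr 2
      · cases x u <;> cases x v <;> rfl
      · rw [cube_congr fun w hw => condNot_of_ne (ne_of_mem_of_not_mem hw hvS) _ x, cube,
          cube, decide_eq_decide]
        refine forall₂_congr fun w hw => ?_
        rw [Function.update_of_ne (ne_of_mem_of_not_mem hw hvS)]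
    ext x w
    rw [ctrl_condNot, ctrl_condNot]
    rcases eq_or_ne w v with rfl | hwv
    · simp [condNot, hvt, hut, huv]
    rcases eq_or_ne w t with rfl | hwt
    · simp only [condNot_of_ne hwv, condNot_self, cond_eq]
    · simp only [condNot_of_ne hwv, condNot_of_ne hwt]

end IsControl

end Control

/-! ### Arithmetic on registers -/

section Registers

variable {W ι V : Type} {r s : ℕ}

/-- The number below `2 ^ r` with given binary digits, the least significant one first. -/
def bitsEquiv (r : ℕ) : (Fin r → Bool) ≃ Fin (2 ^ r) where
  toFun u := ⟨Nat.ofBits u, Nat.ofBits_lt_two_pow u⟩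
  invFun a j := (a : ℕ).testBit j
  left_inv u := by ext j; simp
  right_inv a := Fin.ext (by simp [Nat.ofBits_testBit, Nat.mod_eq_of_lt a.2])

theorem bitsEquiv_succ (u : Fin (r + 1) → Bool) :
    (bitsEquiv (r + 1) u : ℕ) =
      2 ^ r * (u (Fin.last r)).toNat + bitsEquiv r (u ∘ Fin.castSucc) := by
  induction r with
  | zero => simp [bitsEquiv, Nat.ofBits_succ]
  | succ r ih =>
    have h := ih (u ∘ Fin.succ)
    simp only [bitsEquiv, Equiv.coe_fn_mk] at h ⊢
    rw [Nat.ofBits_succ, h, Nat.ofBits_succ (u ∘ Fin.castSucc), pow_succ]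
    simp only [Function.comp_def, Fin.succ_last, Fin.succ_castSucc, Fin.castSucc_zero]
    ring

theorem bitsEquiv_add_one_eq_two_pow {u : Fin r → Bool} :
    (bitsEquiv r u : ℕ) + 1 = 2 ^ r ↔ ∀ j, u j = true := by
  have hpos := Nat.two_pow_pos r
  have hlast : bitsEquiv r ⊤ = ⟨2 ^ r - 1, by omega⟩ := by
    rw [← Equiv.eq_symm_apply]
    ext j
    simp [bitsEquiv]
  calc (bitsEquiv r u : ℕ) + 1 = 2 ^ r ↔ bitsEquiv r u = bitsEquiv r ⊤ := by
        rw [hlast, Fin.ext_iff]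
        exact ⟨Nat.eq_sub_of_add_eq, fun h => by rw [h]; exact Nat.sub_add_cancel hpos⟩
    _ ↔ ∀ j, u j = true := by
        rw [EmbeddingLike.apply_eq_iff_eq, funext_iff]
        rfl

/-- The pair of numbers stored in two registers. -/
def pairEquiv (r s : ℕ) : (Fin r ⊕ Fin s → Bool) ≃ Fin (2 ^ r) × Fin (2 ^ s) :=
  (Equiv.sumArrowEquivProdArrow _ _ _).trans ((bitsEquiv r).prodCongr (bitsEquiv s))

/-- Apply `g` to the value, encoded by `e`, of the register `E`. -/
def regMap (E : ι ↪ W) (e : (ι → Bool) ≃ V) (g : V → V) (x : W → Bool) : W → Bool :=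
  Function.extend E (e.symm (g (e (x ∘ E)))) x

theorem regMap_comp_emb (E : ι ↪ W) (e : (ι → Bool) ≃ V) (g : V → V) (x : W → Bool) :
    e (regMap E e g x ∘ E) = g (e (x ∘ E)) := by
  rw [regMap, Function.extend_comp E.injective, Equiv.apply_symm_apply]

theorem regMap_comp (E : ι ↪ W) (e : (ι → Bool) ≃ V) (g h : V → V) :
    regMap E e (g ∘ h) = fun x => regMap E e g (regMap E e h x) := by
  ext x w
  rw [regMap, regMap, regMap_comp_emb, Function.comp_apply]
  by_cases hw : ∃ j, E j = w
  · obtain ⟨j, rfl⟩ := hw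
    simp only [E.injective.extend_apply]
  · simp only [regMap, Function.extend_apply' _ _ _ hw]

theorem regMap_id (E : ι ↪ W) (e : (ι → Bool) ≃ V) : regMap E e id = fun x => x := by
  ext x w
  rw [regMap, id, Equiv.symm_apply_apply]
  by_cases hw : ∃ j, E j = w
  · obtain ⟨j, rfl⟩ := hw
    exact E.injective.extend_apply _ _ j
  · exact Function.extend_apply' _ _ _ hw

theorem regMap_leftInverse (E : ι ↪ W) (e : (ι → Bool) ≃ V) (g : Equiv.Perm V) :
    Function.LeftInverse (regMap E e g.symm) (regMap E e g) := fun x => by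
  have hcomp := congrFun (regMap_comp E e g.symm g) x
  rwa [Equiv.symm_comp_self, regMap_id, eq_comm] at hcomp

theorem map_trans_subset {κ : Type} [Fintype κ] [Fintype ι] (f : κ ↪ ι) (E : ι ↪ W) :
    Finset.univ.map (f.trans E) ⊆ Finset.univ.map E := by
  rw [← Finset.map_map]
  exact Finset.map_subset_map.2 (Finset.subset_univ _)

variable [Fintype ι]

theorem regMap_fixesOff (E : ι ↪ W) (e : (ι → Bool) ≃ V) (g : V → V) :
    FixesOff (Finset.univ.map E) (regMap E e g) := fun x w hw =>
  Function.extend_apply' _ _ _ (by simpa using hw)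

theorem regMap_eq_of_fixesOff {E : ι ↪ W} {e : (ι → Bool) ≃ V} {g : V → V}
    {f : (W → Bool) → (W → Bool)} (hf : FixesOff (Finset.univ.map E) f)
    (hval : ∀ x, e (f x ∘ E) = g (e (x ∘ E))) : regMap E e g = f := by
  ext x w
  by_cases hw : w ∈ Finset.univ.map E
  · obtain ⟨j, -, rfl⟩ := Finset.mem_map.1 hw
    rw [regMap, ← hval, Equiv.symm_apply_apply, E.injective.extend_apply]
    rfl
  · rw [regMap_fixesOff E e g x w hw, hf x w hw]

end Registers

theorem val_add_one_eq_ite {T : ℕ} [NeZero T] (a : Fin T) :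
    ((a + 1 : Fin T) : ℕ) = if (a : ℕ) + 1 = T then 0 else (a : ℕ) + 1 := by
  have := a.2
  rw [Fin.val_add, Fin.val_one', Nat.add_mod_mod]
  split_ifs with h
  · rw [h, Nat.mod_self]
  · exact Nat.mod_eq_of_lt (by omega)

section Increment

variable {W : Type} {r : ℕ}

/-- A register without its most significant bit. -/
abbrev lowBits (A : Fin (r + 1) ↪ W) : Fin r ↪ W := Fin.castSuccEmb.trans A

/-- The number stored in a register. -/
def regVal (A : Fin r ↪ W) (x : W → Bool) : ℕ := bitsEquiv r (x ∘ A)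

theorem regVal_lt (A : Fin r ↪ W) (x : W → Bool) : regVal A x < 2 ^ r := Fin.is_lt _

theorem regVal_succ (A : Fin (r + 1) ↪ W) (x : W → Bool) :
    regVal A x = 2 ^ r * (x (A (Fin.last r))).toNat + regVal (lowBits A) x :=
  bitsEquiv_succ _

theorem regVal_inj {A : Fin r ↪ W} {x y : W → Bool} :
    regVal A x = regVal A y ↔ ∀ j, x (A j) = y (A j) :=
  Fin.val_inj.trans ((bitsEquiv r).apply_eq_iff_eq.trans funext_iff)

theorem cube_map_top (A : Fin r ↪ W) (x : W → Bool) :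
    cube (Finset.univ.map A) ⊤ x = decide (regVal A x + 1 = 2 ^ r) := by
  simp only [regVal, bitsEquiv_add_one_eq_two_pow, cube, Finset.forall_mem_map, Finset.mem_univ,
    true_implies]
  rfl

/-- Increment a register modulo `2 ^ r`. -/
def increment (A : Fin r ↪ W) : (W → Bool) → (W → Bool) :=
  regMap A (bitsEquiv r) fun a => a + 1

theorem increment_fixesOff (A : Fin r ↪ W) : FixesOff (Finset.univ.map A) (increment A) :=
  regMap_fixesOff _ _ _

theorem regVal_increment (A : Fin r ↪ W) (x : W → Bool) :
    regVal A (increment A x) = if regVal A x + 1 = 2 ^ r then 0 else regVal A x + 1 := by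
  rw [regVal, increment, regMap_comp_emb, val_add_one_eq_ite]
  rfl

variable [DecidableEq W]

theorem regVal_condNot {A : Fin r ↪ W} {t : W} (ht : t ∉ Finset.univ.map A)
    (P : (W → Bool) → Bool) (x : W → Bool) : regVal A (condNot t P x) = regVal A x :=
  regVal_inj.2 fun j => condNot_of_ne (ne_of_mem_of_not_mem (by simp) ht) P x

theorem increment_succ (A : Fin (r + 1) ↪ W) : increment A = fun x =>
    increment (lowBits A) (condNot (A (Fin.last r)) (cube (Finset.univ.map (lowBits A)) ⊤) x) := by
  refine regMap_eq_of_fixesOff (((increment_fixesOff _).mono (map_trans_subset _ _)).comp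
    (condNot_fixesOff (by simp) _)) fun x => Fin.ext ?_
  have hlast (y : W → Bool) : increment (lowBits A) y (A (Fin.last r)) = y (A (Fin.last r)) :=
    increment_fixesOff _ y _ (by simp)
  have hlt := regVal_lt (lowBits A) x
  rw [val_add_one_eq_ite]
  change regVal A _ = if regVal A x + 1 = _ then 0 else regVal A x + 1
  rw [regVal_succ, regVal_succ, hlast, condNot_self, cube_map_top, regVal_increment,
    regVal_condNot (by simp), pow_succ]
  by_cases hmax : regVal (lowBits A) x + 1 = 2 ^ r <;> cases x (A (Fin.last r)) <;>
    simp only [hmax, Bool.toNat_false, Bool.toNat_true, Bool.xor_true, Bool.xor_false,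
      Bool.not_true, Bool.not_false, decide_true, decide_false, ↓reduceIte] <;> grind

variable [Fintype W] {R : Set W} {d : ℕ} {P : (W → Bool) → Bool}

theorem IsControl.computes_increment {A : Fin r ↪ W} (hP : IsControl R (Finset.univ.map A) d P) :
    Computes R (r * d) (ctrl P (increment A)) := by
  induction r with
  | zero =>
    have hid : increment A = fun x => x :=
      regMap_eq_of_fixesOff (fun _ _ _ => rfl) fun _ => Subsingleton.elim (α := Fin 1) _ _
    rw [hid, ctrl_id]
    exact (Computes.id R).mono (by simp)
  | succ r ih =>
    rw [increment_succ, add_mul, one_mul]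
    exact hP.ctrl_comp (condNot_fixesOff (by simp) _) (ih (hP.mono (map_trans_subset _ _)))
      (hP.computes _ (by simp) _ (map_trans_subset _ _) (by simp) ⊤)

end Increment

/-! ### Pairs of registers -/

section Pairs

variable {W : Type} {r s : ℕ}

/-- The first of two disjoint registers. -/
abbrev fstReg (E : Fin r ⊕ Fin s ↪ W) : Fin r ↪ W := Function.Embedding.inl.trans E

/-- The second of two disjoint registers. -/
abbrev sndReg (E : Fin r ⊕ Fin s ↪ W) : Fin s ↪ W := Function.Embedding.inr.trans E

/-- Two registers without their most significant bits. -/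
abbrev lowPair (E : Fin (r + 1) ⊕ Fin (s + 1) ↪ W) : Fin r ⊕ Fin s ↪ W :=
  (Function.Embedding.sumMap Fin.castSuccEmb Fin.castSuccEmb).trans E

/-- The numbers stored in two registers. -/
def pairVal (E : Fin r ⊕ Fin s ↪ W) (x : W → Bool) : Fin (2 ^ r) × Fin (2 ^ s) :=
  pairEquiv r s (x ∘ E)

theorem val_fst_pairVal (E : Fin r ⊕ Fin s ↪ W) (x : W → Bool) :
    ((pairVal E x).1 : ℕ) = regVal (fstReg E) x := rfl

theorem val_snd_pairVal (E : Fin r ⊕ Fin s ↪ W) (x : W → Bool) :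
    ((pairVal E x).2 : ℕ) = regVal (sndReg E) x := rfl

/-- Apply `g` to the numbers stored in two registers. -/
def pairMap (E : Fin r ⊕ Fin s ↪ W)
    (g : Fin (2 ^ r) × Fin (2 ^ s) → Fin (2 ^ r) × Fin (2 ^ s)) : (W → Bool) → (W → Bool) :=
  regMap E (pairEquiv r s) g

variable {E : Fin r ⊕ Fin s ↪ W} {g : Fin (2 ^ r) × Fin (2 ^ s) → Fin (2 ^ r) × Fin (2 ^ s)}

theorem pairMap_fixesOff (E : Fin r ⊕ Fin s ↪ W)
    (g : Fin (2 ^ r) × Fin (2 ^ s) → Fin (2 ^ r) × Fin (2 ^ s)) :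
    FixesOff (Finset.univ.map E) (pairMap E g) := regMap_fixesOff _ _ _

theorem pairVal_pairMap (E : Fin r ⊕ Fin s ↪ W)
    (g : Fin (2 ^ r) × Fin (2 ^ s) → Fin (2 ^ r) × Fin (2 ^ s)) (x : W → Bool) :
    pairVal E (pairMap E g x) = g (pairVal E x) := regMap_comp_emb _ _ _ _

theorem regVal_fst_pairMap (E : Fin r ⊕ Fin s ↪ W)
    (g : Fin (2 ^ r) × Fin (2 ^ s) → Fin (2 ^ r) × Fin (2 ^ s)) (x : W → Bool) :
    regVal (fstReg E) (pairMap E g x) = (g (pairVal E x)).1 := by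
  rw [← val_fst_pairVal, pairVal_pairMap]

theorem regVal_snd_pairMap (E : Fin r ⊕ Fin s ↪ W)
    (g : Fin (2 ^ r) × Fin (2 ^ s) → Fin (2 ^ r) × Fin (2 ^ s)) (x : W → Bool) :
    regVal (sndReg E) (pairMap E g x) = (g (pairVal E x)).2 := by
  rw [← val_snd_pairVal, pairVal_pairMap]

theorem pairMap_eq_of_fixesOff {f : (W → Bool) → (W → Bool)}
    (hf : FixesOff (Finset.univ.map E) f)
    (hfst : ∀ x, regVal (fstReg E) (f x) = (g (pairVal E x)).1)
    (hsnd : ∀ x, regVal (sndReg E) (f x) = (g (pairVal E x)).2) : pairMap E g = f :=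
  regMap_eq_of_fixesOff hf fun x => Prod.ext (Fin.ext (hfst x)) (Fin.ext (hsnd x))

theorem regVal_fstReg_succ (E : Fin (r + 1) ⊕ Fin (s + 1) ↪ W) (x : W → Bool) :
    regVal (fstReg E) x =
      2 ^ r * (x (E (.inl (.last r)))).toNat + regVal (fstReg (lowPair E)) x :=
  regVal_succ _ x

theorem regVal_sndReg_succ (E : Fin (r + 1) ⊕ Fin (s + 1) ↪ W) (x : W → Bool) :
    regVal (sndReg E) x =
      2 ^ s * (x (E (.inr (.last s)))).toNat + regVal (sndReg (lowPair E)) x :=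
  regVal_succ _ x

theorem regVal_fst_pairMap_lowPair (E : Fin (r + 1) ⊕ Fin (s + 1) ↪ W)
    (g : Fin (2 ^ r) × Fin (2 ^ s) → Fin (2 ^ r) × Fin (2 ^ s)) (x : W → Bool) :
    regVal (fstReg E) (pairMap (lowPair E) g x) =
      2 ^ r * (x (E (.inl (.last r)))).toNat + (g (pairVal (lowPair E) x)).1 := by
  rw [← regVal_fst_pairMap, regVal_fstReg_succ]
  congr 3
  exact pairMap_fixesOff _ _ x _ (by simp)

theorem regVal_snd_pairMap_lowPair (E : Fin (r + 1) ⊕ Fin (s + 1) ↪ W)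
    (g : Fin (2 ^ r) × Fin (2 ^ s) → Fin (2 ^ r) × Fin (2 ^ s)) (x : W → Bool) :
    regVal (sndReg E) (pairMap (lowPair E) g x) =
      2 ^ s * (x (E (.inr (.last s)))).toNat + (g (pairVal (lowPair E) x)).2 := by
  rw [← regVal_snd_pairMap, regVal_sndReg_succ]
  congr 3
  exact pairMap_fixesOff _ _ x _ (by simp)

theorem pairVal_congr {x y : W → Bool} (h : ∀ j, x (E j) = y (E j)) : pairVal E x = pairVal E y :=
  congrArg (pairEquiv r s) (funext h)

variable [DecidableEq W]

theorem pairVal_condNot {t : W} (ht : t ∉ Finset.univ.map E) (P : (W → Bool) → Bool)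
    (x : W → Bool) : pairVal E (condNot t P x) = pairVal E x :=
  pairVal_congr fun j => condNot_of_ne (ne_of_mem_of_not_mem (by simp) ht) P x

/-- Three additions exchange the two most significant bits. -/
theorem pairMap_swap_succ (E : Fin (r + 1) ⊕ Fin (r + 1) ↪ W) :
    pairMap E Prod.swap = fun x => pairMap (lowPair E) Prod.swap
      (condNot (E (.inl (.last r))) (fun x => x (E (.inr (.last r))))
        (condNot (E (.inr (.last r))) (fun x => x (E (.inl (.last r))))
          (condNot (E (.inl (.last r))) (fun x => x (E (.inr (.last r)))) x))) := by
  refine pairMap_eq_of_fixesOff ?_ (fun x => ?_) fun x => ?_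
  · exact ((pairMap_fixesOff _ _).mono (map_trans_subset _ _)).comp
      ((condNot_fixesOff (by simp) _).comp ((condNot_fixesOff (by simp) _).comp
        (condNot_fixesOff (by simp) _)))
  · rw [regVal_fst_pairMap_lowPair, pairVal_condNot (by simp), pairVal_condNot (by simp),
      pairVal_condNot (by simp), Prod.fst_swap, val_snd_pairVal, Prod.fst_swap, val_snd_pairVal,
      regVal_sndReg_succ]
    congr 3
    simp [condNot]
  · rw [regVal_snd_pairMap_lowPair, pairVal_condNot (by simp), pairVal_condNot (by simp),
      pairVal_condNot (by simp), Prod.snd_swap, val_fst_pairVal, Prod.snd_swap, val_fst_pairVal,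
      regVal_fstReg_succ]
    congr 3
    simp [condNot, Bool.xor_left_comm]

variable [Fintype W] {R : Set W} {d : ℕ} {P : (W → Bool) → Bool}

theorem IsControl.computes_cnot {U : Finset W} (hP : IsControl R U d P) {u v : W} (hu : u ∈ U)
    (hv : v ∈ U) (huv : u ≠ v) : Computes R d (ctrl P (condNot u fun x => x v)) := by
  rw [← cube_singleton_top]
  exact hP.computes u hu {v} (Finset.singleton_subset_iff.2 hv) (Finset.notMem_singleton.2 huv) ⊤

theorem IsControl.computes_swap {E : Fin r ⊕ Fin r ↪ W}
    (hP : IsControl R (Finset.univ.map E) d P) :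
    Computes R (r * (3 * d)) (ctrl P (pairMap E Prod.swap)) := by
  induction r with
  | zero =>
    have hid : pairMap E Prod.swap = fun x => x :=
      regMap_eq_of_fixesOff (fun _ _ _ => rfl) fun _ => Subsingleton.elim (α := Fin 1 × Fin 1) _ _
    rw [hid, ctrl_id]
    exact (Computes.id R).mono (by simp)
  | succ r ih =>
    have hl : E (.inl (.last r)) ∈ Finset.univ.map E := by simp
    have hr : E (.inr (.last r)) ∈ Finset.univ.map E := by simp
    have hlr : E (.inl (.last r)) ≠ E (.inr (.last r)) := by simp
    have hadd_l := hP.computes_cnot hl hr hlr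
    have hadd_r := hP.computes_cnot hr hl hlr.symm
    have hfix_l := condNot_fixesOff hl fun x => x (E (.inr (.last r)))
    have hfix_r := condNot_fixesOff hr fun x => x (E (.inl (.last r)))
    rw [pairMap_swap_succ]
    exact (hP.ctrl_comp (hfix_l.comp (hfix_r.comp hfix_l))
      (ih (hP.mono (map_trans_subset _ _)))
      (hP.ctrl_comp (hfix_r.comp hfix_l) hadd_l (hP.ctrl_comp hfix_l hadd_r hadd_l))).mono
        (by grind)

end Pairs

/-! ### The circuit of an adjacent transposition -/

section Ranks

/-- If `a < T` and `b + 1 < T` are two consecutive digits of a Lehmer code and `T` values are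
available at the first of them, then `a` and `nextRank T a b` are the ranks of the two entries among
these values. The remaining number `b = T - 1` goes to `a`, which makes the map bijective in `b`. -/
def nextRank (T a b : ℕ) : ℕ := if b < a then b else if b + 1 < T then b + 1 else a

theorem nextRank_lt {T a b : ℕ} (ha : a < T) (hb : b < T) : nextRank T a b < T := by
  grind [nextRank]

/-- Two consecutive digits of a Lehmer code are turned into ranks. -/
def toRanks (T : ℕ) : Equiv.Perm (Fin T × Fin T) where
  toFun p := (p.1, ⟨nextRank T p.1 p.2, nextRank_lt p.1.2 p.2.2⟩)
  invFun p := (p.1, ⟨if p.2 < p.1 then p.2 else if p.1 < p.2 then p.2 - 1 else T - 1,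
    by split_ifs <;> omega⟩)
  left_inv p := by
    refine Prod.ext rfl (Fin.ext ?_)
    grind [nextRank]
  right_inv p := by
    refine Prod.ext rfl (Fin.ext ?_)
    grind [nextRank]

theorem toRanks_fst {T : ℕ} (p : Fin T × Fin T) : (toRanks T p).1 = p.1 := rfl

theorem val_toRanks_snd {T : ℕ} (p : Fin T × Fin T) :
    ((toRanks T p).2 : ℕ) = nextRank T p.1 p.2 := rfl

theorem nextRank_two_mul {T a b : ℕ} {α β β' : Bool} (ha : a < T) (hb : b < T)
    (hβ' : β' = (β ^^ (!α && decide (b + 1 = T)))) :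
    nextRank (2 * T) (T * α.toNat + a) (T * β.toNat + b) = T * β'.toNat +
      if α = β' then nextRank T a b else if α then b else if b + 1 = T then 0 else b + 1 := by
  subst hβ'
  by_cases hmax : b + 1 = T <;> cases α <;> cases β <;> simp [nextRank, hmax] <;> grind

/-- The digits in two consecutive positions of a Lehmer code after the entries in these positions
have been exchanged. -/
def swapDigits (a b : ℕ) : ℕ × ℕ := if b < a then (b, a - 1) else (b + 1, a)

/-- Exchange two consecutive digits by exchanging the ranks. -/
def swapRanks (T : ℕ) : Equiv.Perm (Fin T × Fin T) :=
  ((toRanks T).trans (Equiv.prodComm _ _)).trans (toRanks T).symm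

theorem swapRanks_of_lt {T : ℕ} {p : Fin T × Fin T} (hp : (p.2 : ℕ) + 1 < T) :
    (((swapRanks T p).1 : ℕ), ((swapRanks T p).2 : ℕ)) = swapDigits p.1 p.2 := by
  change (nextRank T p.1 p.2, ite _ _ _) = _
  grind [swapDigits, nextRank, val_toRanks_snd, toRanks_fst]

theorem swapRanks_of_eq {T : ℕ} {p : Fin T × Fin T} (hp : (p.2 : ℕ) + 1 = T) :
    swapRanks T p = p := by
  refine Prod.ext (Fin.ext ?_) (Fin.ext ?_)
  · change nextRank T p.1 p.2 = _
    grind [nextRank]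
  · change ite _ _ _ = _
    grind [nextRank, val_toRanks_snd, toRanks_fst]

end Ranks

section Pairs

variable {W : Type} {r : ℕ}

theorem apply_ctrl_eq {γ : Type} {φ : (W → Bool) → γ} {f : (W → Bool) → (W → Bool)}
    (hf : ∀ x, φ (f x) = φ x) (P : (W → Bool) → Bool) (x : W → Bool) :
    φ (ctrl P f x) = φ x := by
  unfold ctrl
  split_ifs
  exacts [hf x, rfl]

/-- The recursive step of the computation of ranks which acts on all but the most significant bits:
these decide whether the remaining ones are turned into ranks, incremented or left unchanged. -/
def lowRanks (E : Fin (r + 1) ⊕ Fin (r + 1) ↪ W) (x : W → Bool) : W → Bool :=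
  ctrl (fun x => !x (E (.inl (.last r))) && x (E (.inr (.last r))))
    (increment (sndReg (lowPair E)))
    (ctrl (fun x => x (E (.inl (.last r))) == x (E (.inr (.last r))))
      (pairMap (lowPair E) (toRanks (2 ^ r))) x)

theorem lowRanks_fixesOff (E : Fin (r + 1) ⊕ Fin (r + 1) ↪ W) :
    FixesOff (Finset.univ.map (lowPair E)) (lowRanks E) :=
  (((increment_fixesOff _).mono (map_trans_subset _ _)).ctrl _).comp
    ((pairMap_fixesOff _ _).ctrl _)

theorem regVal_fst_lowRanks (E : Fin (r + 1) ⊕ Fin (r + 1) ↪ W) (x : W → Bool) :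
    regVal (fstReg E) (lowRanks E x) = regVal (fstReg E) x := by
  have hinc (y : W → Bool) :
      regVal (fstReg E) (increment (sndReg (lowPair E)) y) = regVal (fstReg E) y :=
    regVal_inj.2 fun j => increment_fixesOff _ y _ (by simp)
  have hrec (y : W → Bool) :
      regVal (fstReg E) (pairMap (lowPair E) (toRanks (2 ^ r)) y) = regVal (fstReg E) y := by
    rw [regVal_fst_pairMap_lowPair, regVal_fstReg_succ, toRanks_fst, val_fst_pairVal]
  exact (apply_ctrl_eq hinc _ _).trans (apply_ctrl_eq hrec _ _)

theorem regVal_snd_lowRanks (E : Fin (r + 1) ⊕ Fin (r + 1) ↪ W) (x : W → Bool) :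
    regVal (sndReg E) (lowRanks E x) = 2 ^ r * (x (E (.inr (.last r)))).toNat +
      if x (E (.inl (.last r))) = x (E (.inr (.last r))) then
        nextRank (2 ^ r) (regVal (fstReg (lowPair E)) x) (regVal (sndReg (lowPair E)) x)
      else if x (E (.inl (.last r))) then regVal (sndReg (lowPair E)) x
      else if regVal (sndReg (lowPair E)) x + 1 = 2 ^ r then 0
      else regVal (sndReg (lowPair E)) x + 1 := by
  unfold lowRanks
  by_cases hlr : x (E (.inl (.last r))) = x (E (.inr (.last r)))
  · rw [ctrl_of_true (P := fun x => _ == _) (by simpa using hlr), ctrl_of_false,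
      regVal_snd_pairMap_lowPair, if_pos hlr, val_toRanks_snd, val_fst_pairVal, val_snd_pairVal]
    rw [pairMap_fixesOff, pairMap_fixesOff, hlr] <;> simp
  rw [ctrl_of_false (P := fun x => _ == _) (by simpa using hlr), if_neg hlr]
  cases hl : x (E (.inl (.last r)))
  · rw [ctrl_of_true (by simpa [hl] using hlr), regVal_sndReg_succ, regVal_increment,
      increment_fixesOff _ _ _ (by simp), if_neg Bool.false_ne_true]
  · rw [ctrl_of_false (by simp [hl]), regVal_sndReg_succ, if_pos rfl]

variable [DecidableEq W]

theorem pairMap_toRanks_succ (E : Fin (r + 1) ⊕ Fin (r + 1) ↪ W) :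
    pairMap E (toRanks (2 ^ (r + 1))) = fun x =>
      lowRanks E (condNot (E (.inr (.last r))) (fun x => !x (E (.inl (.last r))) &&
        cube (Finset.univ.map (sndReg (lowPair E))) ⊤ x) x) := by
  refine pairMap_eq_of_fixesOff (((lowRanks_fixesOff E).mono (map_trans_subset _ _)).comp
    (condNot_fixesOff (by simp) _)) (fun x => ?_) fun x => ?_
  · rw [regVal_fst_lowRanks, regVal_condNot (by simp), toRanks_fst, val_fst_pairVal]
  · rw [regVal_snd_lowRanks, condNot_self, condNot_of_ne (by simp), cube_map_top,
      regVal_condNot (by simp), regVal_condNot (by simp), val_toRanks_snd, val_fst_pairVal,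
      val_snd_pairVal, regVal_fstReg_succ E x, regVal_sndReg_succ E x, pow_succ',
      nextRank_two_mul (regVal_lt _ x) (regVal_lt _ x) rfl]

variable [Fintype W] {R : Set W} {d : ℕ} {P : (W → Bool) → Bool}

theorem IsControl.computes_lowRanks {E : Fin (r + 1) ⊕ Fin (r + 1) ↪ W} {m : ℕ}
    (hP : IsControl R (Finset.univ.map E) d P)
    (hm : Computes R m (ctrl (fun x => P x && (x (E (.inl (.last r))) == x (E (.inr (.last r)))))
      (pairMap (lowPair E) (toRanks (2 ^ r))))) :
    Computes R (r * d + m) (ctrl P (lowRanks E)) := by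
  have hinc : Computes R (r * d) (ctrl P (ctrl (fun x => !x (E (.inl (.last r))) &&
      x (E (.inr (.last r)))) (increment (sndReg (lowPair E))))) := by
    have hcube : (fun x : W → Bool => !x (E (.inl (.last r))) && x (E (.inr (.last r)))) =
        cube {E (.inl (.last r)), E (.inr (.last r))}
          (Function.update ⊤ (E (.inl (.last r))) false) := by
      ext1 x
      rw [Bool.eq_iff_iff, cube_eq_true]
      simp
    rw [hcube, ctrl_ctrl]
    exact (hP.and_cube (by simp [Finset.insert_subset_iff])
      ((map_trans_subset _ _).trans (map_trans_subset _ _)) (by simp) _).computes_increment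
  unfold lowRanks
  rw [← ctrl_ctrl] at hm
  exact hP.ctrl_comp (((pairMap_fixesOff _ _).mono (map_trans_subset _ _)).ctrl _) hinc hm

theorem IsControl.computes_toRanks {E : Fin r ⊕ Fin r ↪ W}
    (hP : IsControl R (Finset.univ.map E) d P) (hR : Set.range E ⊆ R) :
    Computes R (r ^ 2 * (d + 2 * r)) (ctrl P (pairMap E (toRanks (2 ^ r)))) := by
  induction r generalizing d P with
  | zero =>
    have hid : pairMap E (toRanks (2 ^ 0)) = fun x => x :=
      regMap_eq_of_fixesOff (fun _ _ _ => rfl) fun _ => Subsingleton.elim (α := Fin 1 × Fin 1) _ _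
    rw [hid, ctrl_id]
    exact (Computes.id R).mono (by simp)
  | succ r ih =>
    have hrange : Set.range (lowPair E) ⊆ R := by
      rintro _ ⟨j, rfl⟩
      exact hR (Set.mem_range_self _)
    have hlow := ih (E := lowPair E) (hP.and_beq (u := E (.inl (.last r))) (v := E (.inr (.last r)))
      (by simp) (by simp) (hR (Set.mem_range_self _)) (hR (Set.mem_range_self _))
      (map_trans_subset _ _) (by simp) (by simp)) hrange
    have hnot := hP.computes (E (.inr (.last r))) (by simp)
      (insert (E (.inl (.last r))) (Finset.univ.map (sndReg (lowPair E))))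
      (Finset.insert_subset (by simp) ((map_trans_subset _ _).trans (map_trans_subset _ _)))
      (by simp) (Function.update ⊤ (E (.inl (.last r))) false)
    have hcube : (fun x : W → Bool => !x (E (.inl (.last r))) &&
        cube (Finset.univ.map (sndReg (lowPair E))) ⊤ x) =
        cube (insert (E (.inl (.last r))) (Finset.univ.map (sndReg (lowPair E))))
          (Function.update ⊤ (E (.inl (.last r))) false) := by
      ext1 x
      rw [Bool.eq_iff_iff, Bool.and_eq_true, cube_eq_true, cube_eq_true]
      simp
    rw [← hcube] at hnot
    rw [pairMap_toRanks_succ]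
    refine (hP.ctrl_comp (condNot_fixesOff (by simp) _) (hP.computes_lowRanks hlow) hnot).mono ?_
    nlinarith

theorem IsControl.computes_swapRanks {E : Fin r ⊕ Fin r ↪ W}
    (hP : IsControl R (Finset.univ.map E) d P) (hR : Set.range E ⊆ R) :
    Computes R (2 * r ^ 2 * (d + 2 * r) + 3 * r * d) (ctrl P (pairMap E (swapRanks (2 ^ r)))) := by
  have hranks := hP.computes_toRanks hR
  have hsymm := hP.ctrl_of_leftInverse (pairMap_fixesOff E _) hranks
    (regMap_leftInverse E (pairEquiv r r) (toRanks (2 ^ r)))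
  have hcomp : pairMap E (swapRanks (2 ^ r)) = fun x =>
      pairMap E (toRanks (2 ^ r)).symm (pairMap E Prod.swap (pairMap E (toRanks (2 ^ r)) x)) := by
    have hswap : ⇑(swapRanks (2 ^ r)) =
        (toRanks (2 ^ r)).symm ∘ Prod.swap ∘ toRanks (2 ^ r) := rfl
    simp only [pairMap, hswap, regMap_comp]
  rw [hcomp]
  exact (hP.ctrl_comp ((pairMap_fixesOff _ _).comp (pairMap_fixesOff _ _)) hsymm
    (hP.ctrl_comp (pairMap_fixesOff _ _) hP.computes_swap hranks)).mono (by grind)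

end Pairs

section Carry

variable {W : Type} {q : ℕ}

/-- Two registers the first of which has one more bit, without this bit. -/
abbrev tailPair (E : Fin (q + 1) ⊕ Fin q ↪ W) : Fin q ⊕ Fin q ↪ W :=
  (Function.Embedding.sumMap Fin.castSuccEmb (.refl _)).trans E

/-- The exchange of two numbers followed by the addition of `1` to the first. -/
def swapSucc (T : ℕ) [NeZero T] : Equiv.Perm (Fin T × Fin T) :=
  (Equiv.prodComm _ _).trans ((Equiv.addRight 1).prodCongr (.refl _))

theorem val_neg_one_add_one (T : ℕ) [NeZero T] : ((-1 : Fin T) : ℕ) + 1 = T := by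
  obtain ⟨m, rfl⟩ := Nat.exists_eq_succ_of_ne_zero (NeZero.ne T)
  rw [Fin.coe_neg_one]

variable [DecidableEq W]

/-- Exchange consecutive digits if the first has one more bit than the second. This bit is only set
if the first digit is maximal; `swapSucc` is then undone, so that the maximality of the second digit
tells whether the bit has to be changed. -/
def swapCarry (E : Fin (q + 1) ⊕ Fin q ↪ W) (x : W → Bool) : W → Bool :=
  ctrl (fun x => !x (E (.inl (.last q)))) (pairMap (tailPair E) (swapRanks (2 ^ q)))
    (ctrl (fun x => x (E (.inl (.last q)))) (pairMap (tailPair E) (swapSucc (2 ^ q)))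
      (condNot (E (.inl (.last q))) (cube (Finset.univ.map (sndReg (tailPair E))) ⊤)
        (ctrl (fun x => x (E (.inl (.last q)))) (pairMap (tailPair E) (swapSucc (2 ^ q)).symm) x)))

theorem swapCarry_of_true {E : Fin (q + 1) ⊕ Fin q ↪ W} {x : W → Bool}
    (htop : x (E (.inl (.last q))) = true) (hfst : (pairVal (tailPair E) x).1 = 0) :
    swapCarry E x (E (.inl (.last q))) = false ∧
      pairVal (tailPair E) (swapCarry E x) = ((pairVal (tailPair E) x).2, -1) := by
  have hne : E (.inl (.last q)) ∉ Finset.univ.map (tailPair E) := by simp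
  set y := pairMap (tailPair E) (swapSucc (2 ^ q)).symm x with hy
  have hy_top : y (E (.inl (.last q))) = true := (pairMap_fixesOff _ _ x _ hne).trans htop
  have hy_val : pairVal (tailPair E) y = ((pairVal (tailPair E) x).2, -1) := by
    rw [hy, pairVal_pairMap]
    exact Prod.ext rfl (by simp [swapSucc, hfst])
  have hmax : regVal (sndReg (tailPair E)) y + 1 = 2 ^ q := by
    rw [← val_snd_pairVal, hy_val, val_neg_one_add_one]
  set z := condNot (E (.inl (.last q))) (cube (Finset.univ.map (sndReg (tailPair E))) ⊤) y with hz
  have hz_top : z (E (.inl (.last q))) = false := by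
    rw [hz, condNot_self, cube_map_top, hy_top, hmax]
    simp
  have hz_val : pairVal (tailPair E) z = ((pairVal (tailPair E) x).2, -1) := by
    rw [hz, pairVal_condNot hne, hy_val]
  have hcarry : swapCarry E x = pairMap (tailPair E) (swapRanks (2 ^ q)) z := by
    simp [swapCarry, ctrl, htop, hz_top, ← hy, ← hz]
  rw [hcarry, pairMap_fixesOff _ _ z _ hne, hz_top, pairVal_pairMap, swapRanks_of_eq, hz_val]
  · exact ⟨rfl, rfl⟩
  · rw [hz_val, val_neg_one_add_one]

theorem swapCarry_of_false {E : Fin (q + 1) ⊕ Fin q ↪ W} {x : W → Bool}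
    (htop : x (E (.inl (.last q))) = false) :
    swapCarry E x (E (.inl (.last q))) = decide (regVal (sndReg E) x + 1 = 2 ^ q) ∧
      pairVal (tailPair E) (swapCarry E x) =
        if regVal (sndReg E) x + 1 = 2 ^ q then swapSucc (2 ^ q) (pairVal (tailPair E) x)
        else swapRanks (2 ^ q) (pairVal (tailPair E) x) := by
  have hne : E (.inl (.last q)) ∉ Finset.univ.map (tailPair E) := by simp
  set z := condNot (E (.inl (.last q))) (cube (Finset.univ.map (sndReg (tailPair E))) ⊤) x with hz
  have hz_top : z (E (.inl (.last q))) = decide (regVal (sndReg E) x + 1 = 2 ^ q) := by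
    rw [hz, condNot_self, cube_map_top, htop, Bool.false_xor]
    rfl
  have hz_val : pairVal (tailPair E) z = pairVal (tailPair E) x := by
    rw [hz, pairVal_condNot hne]
  have hcarry : swapCarry E x = pairMap (tailPair E)
      (if regVal (sndReg E) x + 1 = 2 ^ q then swapSucc (2 ^ q) else swapRanks (2 ^ q)) z := by
    by_cases hmax : regVal (sndReg E) x + 1 = 2 ^ q
    · simp [swapCarry, ctrl, htop, hz_top, ← hz, hmax, pairMap_fixesOff _ _ z _ hne]
    · simp [swapCarry, ctrl, htop, hz_top, ← hz, hmax]
  rw [hcarry, pairMap_fixesOff _ _ z _ hne, hz_top, pairVal_pairMap, hz_val]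
  split_ifs <;> simp [*]

theorem regVal_swapCarry {E : Fin (q + 1) ⊕ Fin q ↪ W} {x : W → Bool}
    (hx : regVal (fstReg E) x ≤ 2 ^ q) :
    (regVal (fstReg E) (swapCarry E x), regVal (sndReg E) (swapCarry E x)) =
      swapDigits (regVal (fstReg E) x) (regVal (sndReg E) x) := by
  have hfst (y : W → Bool) : regVal (fstReg E) y =
      2 ^ q * (y (E (.inl (.last q)))).toNat + (pairVal (tailPair E) y).1 := regVal_succ _ y
  have hsnd (y : W → Bool) : regVal (sndReg E) y = (pairVal (tailPair E) y).2 := rfl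
  have hfst_lt := (pairVal (tailPair E) x).1.is_lt
  have hsnd_lt := regVal_lt (sndReg E) x
  cases htop : x (E (.inl (.last q)))
  · obtain ⟨hbit, hval⟩ := swapCarry_of_false htop
    rw [hfst x, hfst (swapCarry E x), hsnd (swapCarry E x), hbit, hval, htop]
    by_cases hmax : regVal (sndReg E) x + 1 = 2 ^ q
    · have hzero : (swapSucc (2 ^ q) (pairVal (tailPair E) x)).1 = 0 :=
        Fin.ext ((val_add_one_eq_ite _).trans (if_pos hmax))
      rw [if_pos hmax, hzero, swapDigits, if_neg (by grind)]
      simp [hmax, swapSucc]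
    · rw [if_neg hmax, decide_eq_false hmax, hsnd x]
      simpa only [Bool.toNat_false, mul_zero, zero_add] using
        swapRanks_of_lt (p := pairVal (tailPair E) x) (by grind)
  · have hzero : (pairVal (tailPair E) x).1 = 0 := by
      rw [hfst, htop] at hx
      exact Fin.ext (by simpa using hx)
    obtain ⟨hbit, hval⟩ := swapCarry_of_true htop hzero
    rw [hfst x, hfst (swapCarry E x), hsnd (swapCarry E x), hbit, hval, htop, hzero, swapDigits,
      if_pos (by simpa using hsnd_lt)]
    refine Prod.ext (by simp [hsnd]) ?_
    simpa using Nat.eq_sub_of_add_eq (val_neg_one_add_one (2 ^ q))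

theorem swapCarry_fixesOff (E : Fin (q + 1) ⊕ Fin q ↪ W) :
    FixesOff (Finset.univ.map E) (swapCarry E) := by
  have hpair (P : (W → Bool) → Bool) (g : Equiv.Perm (Fin (2 ^ q) × Fin (2 ^ q))) :
      FixesOff (Finset.univ.map E) (ctrl P (pairMap (tailPair E) g)) :=
    ((pairMap_fixesOff _ _).mono (map_trans_subset _ _)).ctrl P
  exact (hpair _ _).comp ((hpair _ _).comp ((condNot_fixesOff (by simp) _).comp (hpair _ _)))

variable [Fintype W] {R : Set W} {d : ℕ} {P : (W → Bool) → Bool}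

theorem IsControl.computes_swapSucc {E : Fin q ⊕ Fin q ↪ W}
    (hP : IsControl R (Finset.univ.map E) d P) :
    Computes R (4 * q * d) (ctrl P (pairMap E (swapSucc (2 ^ q)))) := by
  have hcomp : pairMap E (swapSucc (2 ^ q)) = fun x =>
      increment (fstReg E) (pairMap E Prod.swap x) := by
    refine pairMap_eq_of_fixesOff (((increment_fixesOff _).mono (map_trans_subset _ _)).comp
      (pairMap_fixesOff _ _)) (fun x => ?_) fun x => ?_
    · rw [regVal_increment, regVal_fst_pairMap]
      exact (val_add_one_eq_ite (pairVal E x).2).symm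
    · rw [regVal_inj.2 fun j => increment_fixesOff _ _ _ (by simp), regVal_snd_pairMap]
      rfl
  rw [hcomp]
  exact (hP.ctrl_comp (pairMap_fixesOff _ _)
    (hP.mono (map_trans_subset _ _)).computes_increment hP.computes_swap).mono (by grind)

theorem IsControl.computes_swapCarry {E : Fin (q + 1) ⊕ Fin q ↪ W}
    (hP : IsControl R (Finset.univ.map E) d fun _ => true) (hR : Set.range E ⊆ R) :
    Computes R ((2 * q ^ 2 + 11 * q + 1) * d + 4 * q ^ 3) (swapCarry E) := by
  have hcontrol (b : Bool) : IsControl R (Finset.univ.map (tailPair E)) d fun x =>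
      x (E (.inl (.last q))) == b := by
    convert hP.and_cube (T := {E (.inl (.last q))}) (V := Finset.univ.map (tailPair E))
      (by simp) (map_trans_subset _ E) (by simp) (fun _ => b) using 2 with x
    rw [Bool.true_and, Bool.eq_iff_iff, cube_eq_true]
    simp
  have hset := hcontrol true
  have hunset := hcontrol false
  simp only [beq_true, beq_false] at hset hunset
  have hadd := hset.computes_swapSucc
  have hsub := hset.ctrl_of_leftInverse (pairMap_fixesOff _ _) hadd
    (regMap_leftInverse (tailPair E) (pairEquiv q q) (swapSucc (2 ^ q)))
  have hnot := hP.computes (E (.inl (.last q))) (by simp)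
    (Finset.univ.map (sndReg (tailPair E))) ((map_trans_subset _ _).trans (map_trans_subset _ _))
    (by simp) ⊤
  have hrange : Set.range (tailPair E) ⊆ R := by
    rintro _ ⟨j, rfl⟩
    exact hR (Set.mem_range_self _)
  exact ((hunset.computes_swapRanks hrange).comp (hadd.comp (hnot.comp hsub))).mono (by grind)

end Carry

theorem exists_computes_swapDigits {W : Type} [DecidableEq W] [Fintype W] {R : Set W} {r s m : ℕ}
    (E : Fin r ⊕ Fin s ↪ W) (hR : Set.range E ⊆ R) (hrs : r = s ∨ r = s + 1)
    (hr : m + 1 ≤ 2 ^ r) (hs : m ≤ 2 ^ s) :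
    ∃ f, Computes R (4000 * (s + 1) ^ 4) f ∧ FixesOff (Finset.univ.map E) f ∧
      ∀ x, regVal (fstReg E) x ≤ m → regVal (sndReg E) x < m →
        (regVal (fstReg E) (f x), regVal (sndReg E) (f x)) =
          swapDigits (regVal (fstReg E) x) (regVal (sndReg E) x) := by
  have hcontrol : IsControl R (Finset.univ.map E) (156 * (r + s) ^ 2) fun _ => true := by
    simpa using isControl_true (U := Finset.univ.map E) (R := R) (by simpa using hR)
  rcases hrs with rfl | rfl
  · refine ⟨pairMap E (swapRanks (2 ^ r)), (hcontrol.computes_swapRanks hR).mono (by grind),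
      pairMap_fixesOff _ _, fun x _ hx => ?_⟩
    rw [regVal_fst_pairMap, regVal_snd_pairMap]
    exact swapRanks_of_lt (p := pairVal E x) (by rw [val_snd_pairVal]; omega)
  · exact ⟨swapCarry E, (hcontrol.computes_swapCarry hR).mono (by grind), swapCarry_fixesOff E,
      fun x hx _ => regVal_swapCarry (hx.trans hs)⟩

/-! ### Lehmer codes -/

section Lehmer

variable {n : ℕ} {σ ρ : Equiv.Perm (Fin n)} {i i' : Fin n}

theorem lehmer_eq_card_filter_Ioi (σ : Equiv.Perm (Fin n)) (i : Fin n) :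
    lehmer σ i = {j ∈ Finset.Ioi i | σ j < σ i}.card := by
  rw [lehmer]
  congr 1
  ext j
  simp

theorem lehmer_eq_card_sdiff (σ : Equiv.Perm (Fin n)) (i : Fin n) :
    lehmer σ i = (Finset.Iio (σ i) \ (Finset.Iio i).map σ.toEmbedding).card := by
  rw [lehmer, ← Finset.card_map σ.toEmbedding]
  congr 1
  ext v
  obtain ⟨j, rfl⟩ := σ.surjective v
  suffices i < j ∧ σ j < σ i ↔ σ j < σ i ∧ i ≤ j by simpa
  grind [σ.injective.eq_iff]

theorem lehmer_le (σ : Equiv.Perm (Fin n)) (i : Fin n) : lehmer σ i ≤ n - 1 - i := by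
  rw [← Fin.card_Ioi i, lehmer_eq_card_filter_Ioi]
  exact Finset.card_filter_le _ _

theorem lehmer_eq_max_iff : lehmer σ i = n - 1 - i ↔ ∀ j, i < j → σ j < σ i := by
  rw [← Fin.card_Ioi i, lehmer_eq_card_filter_Ioi, Finset.card_filter_eq_iff]
  simp

theorem lehmer_lt_of_lt (h : ∀ j < i, σ j = ρ j) (hlt : σ i < ρ i) : lehmer σ i < lehmer ρ i := by
  have himage : (Finset.Iio i).map ρ.toEmbedding = (Finset.Iio i).map σ.toEmbedding := by
    simp only [Finset.map_eq_image]
    exact Finset.image_congr fun j hj => (h j (by simpa using hj)).symm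
  rw [lehmer_eq_card_sdiff, lehmer_eq_card_sdiff, himage]
  refine Finset.card_lt_card <| (Finset.ssubset_iff_of_subset <|
    Finset.sdiff_subset_sdiff (Finset.Iio_subset_Iio hlt.le) le_rfl).2 ⟨σ i, ?_, ?_⟩ <;>
  simp [hlt]

theorem lehmer_eq_iff_of_lt (h : ∀ j < i, σ j = ρ j) : lehmer σ i = lehmer ρ i ↔ σ i = ρ i := by
  rcases lt_trichotomy (σ i) (ρ i) with hlt | heq | hgt
  · exact iff_of_false (lehmer_lt_of_lt h hlt).ne hlt.ne
  · rw [lehmer_eq_card_sdiff, lehmer_eq_card_sdiff, heq, Finset.map_eq_image, Finset.map_eq_image]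
    refine iff_of_true (congrArg (fun A => (Finset.Iio (ρ i) \ A).card) ?_) rfl
    exact Finset.image_congr fun j hj => h j (by simpa using hj)
  · exact iff_of_false (lehmer_lt_of_lt (fun j hj => (h j hj).symm) hgt).ne' hgt.ne'

theorem forall_lehmer_eq_iff {k : ℕ} :
    (∀ i : Fin n, (i : ℕ) < k → lehmer σ i = lehmer ρ i) ↔
      ∀ i : Fin n, (i : ℕ) < k → σ i = ρ i := by
  refine ⟨fun h i => ?_, fun h i hi =>
    (lehmer_eq_iff_of_lt fun j hj => h j (lt_trans hj hi)).2 (h i hi)⟩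
  induction i using WellFoundedLT.induction with
  | ind i ih =>
    exact fun hi => (lehmer_eq_iff_of_lt fun j hj => ih j hj (lt_trans hj hi)).1 (h i hi)

theorem lehmer_of_covBy (h : i ⋖ i') (σ : Equiv.Perm (Fin n)) :
    lehmer σ i = {j ∈ Finset.Ioi i' | σ j < σ i}.card + if σ i' < σ i then 1 else 0 := by
  have hIoi : Finset.Ioi i = insert i' (Finset.Ioi i') := by
    rw [← Finset.coe_inj, Finset.coe_insert, Finset.coe_Ioi, Finset.coe_Ioi, h.Ioi_eq,
      Set.Ioi_insert]
  rw [lehmer_eq_card_filter_Ioi, hIoi, Finset.filter_insert]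
  split_ifs <;> simp

theorem lehmer_mul_swap (h : i ⋖ i') (σ : Equiv.Perm (Fin n)) :
    (lehmer (σ * Equiv.swap i i') i, lehmer (σ * Equiv.swap i i') i') =
      swapDigits (lehmer σ i) (lehmer σ i') := by
  have htail (v : Fin n) : {j ∈ Finset.Ioi i' | (σ * Equiv.swap i i') j < v} =
      {j ∈ Finset.Ioi i' | σ j < v} := Finset.filter_congr fun j hj => by
    have hj := Finset.mem_Ioi.1 hj
    rw [Equiv.Perm.mul_apply, Equiv.swap_apply_of_ne_of_ne (h.lt.trans hj).ne' hj.ne']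
  have hmono {u v : Fin n} (huv : u ≤ v) :
      {j ∈ Finset.Ioi i' | σ j < u}.card ≤ {j ∈ Finset.Ioi i' | σ j < v}.card :=
    Finset.card_le_card <| Finset.monotone_filter_right _ fun _ _ hj => hj.trans_le huv
  rw [lehmer_of_covBy h, lehmer_of_covBy h, lehmer_eq_card_filter_Ioi _ i',
    lehmer_eq_card_filter_Ioi _ i', htail, htail, Equiv.Perm.mul_apply, Equiv.Perm.mul_apply,
    Equiv.swap_apply_left, Equiv.swap_apply_right, swapDigits]
  rcases (σ.injective.ne h.lt.ne).lt_or_gt with hlt | hgt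
  · have := hmono hlt.le
    simp [hlt, hlt.not_gt, this]
  · have := hmono hgt.le
    simp [hgt, hgt.not_gt, Nat.lt_succ_of_le this]

theorem lehmer_mul_swap_of_ne (h : i ⋖ i') (σ : Equiv.Perm (Fin n)) {j : Fin n} (hj : j ≠ i)
    (hj' : j ≠ i') : lehmer (σ * Equiv.swap i i') j = lehmer σ j := by
  have hlt (l : Fin n) : j < Equiv.swap i i' l ↔ j < l := by
    have : j < i ↔ j < i' :=
      ⟨fun hji => hji.trans h.lt, fun hji => lt_of_le_of_ne (h.le_of_lt hji) hj⟩
    rw [Equiv.swap_apply_def]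
    split_ifs with hl hl <;> simp [hl, this]
  refine Finset.card_equiv (Equiv.swap i i') fun l => ?_
  simp [hlt, Equiv.swap_apply_of_ne_of_ne hj hj']

theorem lehmer_lt_two_pow_clog (σ : Equiv.Perm (Fin n)) (i : Fin n) :
    lehmer σ i < 2 ^ Nat.clog 2 (n - i) :=
  have := lehmer_le σ i
  lt_of_lt_of_le (by omega) (Nat.le_pow_clog one_lt_two (n - i))

/-- The qubits of the `i`-th digit of the Lehmer register, in increasing order of significance. -/
def digitReg (i : Fin n) : Fin (Nat.clog 2 (n - i)) ↪ LehmerWire n :=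
  Function.Embedding.sigmaMk (β := fun i : Fin n => Fin (Nat.clog 2 (n - i))) i

theorem regVal_digitReg_lehmerBits (σ : Equiv.Perm (Fin n)) (i : Fin n) :
    regVal (digitReg i) (lehmerBits σ) = lehmer σ i :=
  (Nat.ofBits_testBit _ _).trans (Nat.mod_eq_of_lt (lehmer_lt_two_pow_clog σ i))

end Lehmer

/-! ### Circuits on the Lehmer register -/

section LehmerRegister

variable {n : ℕ} {σ ρ : Equiv.Perm (Fin n)} {i i' : Fin n}

theorem eq_lehmerBits_iff {x : LehmerWire n → Bool} :
    x = lehmerBits σ ↔ ∀ i, regVal (digitReg i) x = lehmer σ i := by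
  simp only [← regVal_digitReg_lehmerBits, regVal_inj, funext_iff, Sigma.forall]
  rfl

theorem lehmer_eq_iff_lehmerBits_eq :
    lehmer σ i = lehmer ρ i ↔ ∀ j, lehmerBits σ ⟨i, j⟩ = lehmerBits ρ ⟨i, j⟩ := by
  rw [← regVal_digitReg_lehmerBits, ← regVal_digitReg_lehmerBits, regVal_inj]
  rfl

theorem clog_two_add_one (m : ℕ) :
    Nat.clog 2 (m + 1) = Nat.clog 2 m ∨ Nat.clog 2 (m + 1) = Nat.clog 2 m + 1 := by
  have hle : Nat.clog 2 m ≤ Nat.clog 2 (m + 1) := Nat.clog_mono_right 2 m.le_succ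
  have hge : Nat.clog 2 (m + 1) ≤ Nat.clog 2 m + 1 := by
    refine Nat.clog_le_of_le_pow ?_
    have := Nat.le_pow_clog one_lt_two m
    have := Nat.one_le_two_pow (n := Nat.clog 2 m)
    omega
  omega

/-- The qubits of two distinct digits of the Lehmer register. -/
def digitPair (h : i ≠ i') :
    Fin (Nat.clog 2 (n - i)) ⊕ Fin (Nat.clog 2 (n - i')) ↪ LehmerWire n where
  toFun := Sum.elim (digitReg i) (digitReg i')
  inj' := (digitReg i).injective.sumElim (digitReg i').injective fun _ _ e =>
    h (congrArg Sigma.fst e)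

theorem mem_range_digitPair {h : i ≠ i'} {w : LehmerWire n} :
    w ∈ Set.range (digitPair h) ↔ w.1 = i ∨ w.1 = i' := by
  obtain ⟨l, j⟩ := w
  constructor
  · rintro ⟨j | j, hj⟩
    · exact Or.inl (congrArg Sigma.fst hj).symm
    · exact Or.inr (congrArg Sigma.fst hj).symm
  · rintro (rfl | rfl)
    exacts [⟨Sum.inl j, rfl⟩, ⟨Sum.inr j, rfl⟩]

theorem exists_computes_lehmerBits_mul_swap (h : (i : ℕ) + 1 = i') :
    ∃ f, Computes {w : LehmerWire n | w.1 = i ∨ w.1 = i'} (4000 * (Nat.clog 2 n + 1) ^ 4) f ∧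
      ∀ σ, f (lehmerBits σ) = lehmerBits (σ * Equiv.swap i i') := by
  have hcov : i ⋖ i' := Fin.covBy_iff.2 (Nat.covBy_iff_add_one_eq.2 h)
  obtain ⟨f, hfR, hfix, hf⟩ := exists_computes_swapDigits (digitPair hcov.ne) (m := n - i')
    (R := {w | w.1 = i ∨ w.1 = i'}) (fun w => mem_range_digitPair.1)
    (by rw [show n - (i : ℕ) = n - i' + 1 by omega]; exact clog_two_add_one _)
    (by rw [show n - (i' : ℕ) + 1 = n - i by omega]; exact Nat.le_pow_clog one_lt_two _)
    (Nat.le_pow_clog one_lt_two _)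
  have hclog : Nat.clog 2 (n - i') ≤ Nat.clog 2 n := Nat.clog_mono_right 2 (Nat.sub_le _ _)
  refine ⟨f, hfR.mono (by gcongr), fun σ => eq_lehmerBits_iff.2 fun l => ?_⟩
  have hpair : (regVal (digitReg i) (f (lehmerBits σ)), regVal (digitReg i') (f (lehmerBits σ))) =
      swapDigits (lehmer σ i) (lehmer σ i') := by
    rw [← regVal_digitReg_lehmerBits σ i, ← regVal_digitReg_lehmerBits σ i']
    refine hf _ ?_ ?_
    · refine (regVal_digitReg_lehmerBits σ i).trans_le ((lehmer_le σ i).trans ?_)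
      omega
    · refine (regVal_digitReg_lehmerBits σ i').trans_lt ((lehmer_le σ i').trans_lt ?_)
      omega
  rw [← lehmer_mul_swap hcov, Prod.mk.injEq] at hpair
  by_cases hl : l = i
  · exact hl ▸ hpair.1
  by_cases hl' : l = i'
  · exact hl' ▸ hpair.2
  rw [lehmer_mul_swap_of_ne hcov σ hl hl', ← regVal_digitReg_lehmerBits, regVal_inj]
  refine fun j => hfix _ _ ?_
  rw [← Finset.mem_coe, Finset.coe_map, Finset.coe_univ, Set.image_univ, mem_range_digitPair]
  exact not_or.2 ⟨hl, hl'⟩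

theorem exists_implementsReorder_adjSwap (s : Fin (n - 1)) :
    ∃ c : Circuit (LehmerWire n),
      c.ActsOn {w | (w.1 : ℕ) = (s : ℕ) ∨ (w.1 : ℕ) = (s : ℕ) + 1} ∧
      ImplementsReorder c (adjSwap s) ∧ c.depth ≤ 4000 * (Nat.clog 2 n + 1) ^ 4 := by
  obtain ⟨f, ⟨c, hcR, hcd, hcf⟩, hf⟩ := exists_computes_lehmerBits_mul_swap
    (i := (⟨s, by omega⟩ : Fin n)) (i' := ⟨s + 1, by omega⟩) rfl
  refine ⟨c, by simpa only [Fin.ext_iff] using hcR, fun σ => ?_, hcd⟩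
  rw [hcf, mapMat_mulVec_ket, hf]
  rfl

theorem exists_computesAfterReorder {I : Finset (Fin n)} {π ρ : Equiv.Perm (Fin n)}
    {φ : Equiv.Perm (Fin n) → Prop}
    (hφ : ∀ σ, φ σ ↔ ∀ i ∈ I, lehmer (σ * π) i = lehmer ρ i) :
    ∃ Q : Circuit (Option (LehmerWire n)),
      Q.ActsOn {o | ∀ w, o = some w → w.1 ∈ I} ∧ ComputesAfterReorder Q π φ ∧
      Q.depth ≤ 156 * (I.card * Nat.clog 2 n + 1) ^ 2 := by
  classical
  set S : Finset (LehmerWire n) := I.sigma fun _ => Finset.univ with hS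
  have hcard : S.card ≤ I.card * Nat.clog 2 n := by
    rw [hS, Finset.card_sigma]
    refine Finset.sum_le_card_nsmul _ _ _ fun i _ => ?_
    rw [Finset.card_fin]
    exact Nat.clog_mono_right 2 (Nat.sub_le _ _)
  obtain ⟨Q, hQR, hQd, hQ⟩ := Computes.condNot_cube (t := none)
    (R := {o : Option (LehmerWire n) | ∀ w, o = some w → w.1 ∈ I})
    (S := S.map Function.Embedding.some) (withOutput (lehmerBits ρ) true)
    (by rintro _ hw w rfl; simpa [hS] using hw) (by simp) (by simp)
  refine ⟨Q, hQR, fun σ b => ?_, hQd.trans (by rw [Finset.card_map]; gcongr)⟩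
  have hcube : cube (S.map Function.Embedding.some) (withOutput (lehmerBits ρ) true)
      (withOutput (lehmerBits (σ * π)) b) = decide (φ σ) := by
    rw [Bool.eq_iff_iff, cube_eq_true, decide_eq_true_iff, hφ, Finset.forall_mem_map]
    simp only [lehmer_eq_iff_lehmerBits_eq, hS, Finset.mem_sigma, Finset.mem_univ, and_true,
      Sigma.forall, forall_comm (α := _ ∈ I)]
    rfl
  rw [hQ, mapMat_mulVec_ket]
  congr 1
  funext o
  cases o with
  | none => rw [condNot_self, hcube]; rfl
  | some w => rw [condNot_of_ne (Option.some_ne_none w)]; rfl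

end LehmerRegister

/-! ### Words of adjacent transpositions -/

section Words

variable {n : ℕ}

theorem adjSwap_val (s : Fin (n - 1)) (p : Fin n) :
    (adjSwap s p : ℕ) = if (p : ℕ) = s then (s : ℕ) + 1 else if (p : ℕ) = s + 1 then s else p := by
  rw [adjSwap, Equiv.swap_apply_def]
  simp only [Fin.ext_iff]
  split_ifs <;> rfl

theorem wordPerm_nil : wordPerm ([] : List (Fin (n - 1))) = 1 := rfl

theorem wordPerm_cons (s : Fin (n - 1)) (w : List (Fin (n - 1))) :
    wordPerm (s :: w) = adjSwap s * wordPerm w := List.prod_cons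

theorem wordPerm_append (v w : List (Fin (n - 1))) :
    wordPerm (v ++ w) = wordPerm v * wordPerm w := by simp [wordPerm]

theorem wordPerm_concat (w : List (Fin (n - 1))) (s : Fin (n - 1)) :
    wordPerm (w.concat s) = wordPerm w * adjSwap s := by
  simp [wordPerm]

theorem wordPerm_descending_val {m : ℕ} (hm : m ≤ n - 1) (p : Fin n) :
    (wordPerm (List.ofFn (Fin.castLE hm)).reverse p : ℕ) =
      if (p : ℕ) = 0 then m else if (p : ℕ) ≤ m then (p : ℕ) - 1 else p := by
  induction m with
  | zero =>
    simp only [List.ofFn_zero, List.reverse_nil, wordPerm_nil, Equiv.Perm.one_apply]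
    split_ifs <;> omega
  | succ m ih =>
    have ih := ih (Nat.le_of_succ_le hm)
    rw [List.ofFn_succ', List.concat_eq_append, List.reverse_concat, wordPerm_cons,
      Equiv.Perm.mul_apply, adjSwap_val]
    simp only [Fin.castLE_castSucc, Fin.val_castLE, Fin.val_last, ih]
    split_ifs <;> omega

theorem wordPerm_ascending_val {t m : ℕ} (hm : t + m ≤ n - 1) (p : Fin n) :
    (wordPerm (List.ofFn fun s : Fin m => (⟨t + s, by omega⟩ : Fin (n - 1))) p : ℕ) =
      if (p : ℕ) = t + m then t else if t ≤ p ∧ p < t + m then (p : ℕ) + 1 else p := by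
  induction m generalizing p with
  | zero =>
    simp only [List.ofFn_zero, wordPerm_nil, Equiv.Perm.one_apply]
    split_ifs <;> omega
  | succ m ih =>
    rw [List.ofFn_succ', wordPerm_concat, Equiv.Perm.mul_apply]
    simp only [Fin.val_castSucc, Fin.val_last, ih (Nat.le_of_succ_le hm), adjSwap_val]
    split_ifs <;> omega

theorem wordPerm_frontWord_val (t p : Fin n) :
    (wordPerm (frontWord t) p : ℕ) =
      if (p : ℕ) = 0 then (t : ℕ) else if p ≤ t then (p : ℕ) - 1 else p :=
  wordPerm_descending_val (Nat.le_sub_one_of_lt t.2) p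

theorem wordPerm_backWord_val (t p : Fin n) :
    (wordPerm (backWord t) p : ℕ) =
      if (p : ℕ) = n - 1 then (t : ℕ) else if t ≤ p then (p : ℕ) + 1 else p := by
  rw [backWord, wordPerm_ascending_val (by omega)]
  simp only [Fin.le_def]
  split_ifs <;> omega

theorem exists_wordPerm_flatMap {F : Fin n → List (Fin (n - 1))} {q : ℕ → ℕ → ℕ}
    (hlast : ∀ k (t p : Fin n), (∀ l < k, (t : ℕ) ≠ q k l) → (p : ℕ) = q (k + 1) k →
      wordPerm (F t) p = t)
    (hcast : ∀ k (t p : Fin n), (∀ l < k, (t : ℕ) ≠ q k l) → ∀ l < k, (p : ℕ) = q (k + 1) l →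
      (wordPerm (F t) p : ℕ) = q k l)
    {k : ℕ} (i : Fin k ↪ Fin n) :
    ∃ ts : List (Fin n), ts.length = k ∧
      ∀ (l : Fin k) (p : Fin n), (p : ℕ) = q k l → wordPerm (ts.flatMap F) p = i l := by
  induction k with
  | zero => exact ⟨[], rfl, fun l => l.elim0⟩
  | succ k ih =>
    obtain ⟨ts, hlen, hts⟩ := ih (Fin.castSuccEmb.trans i)
    obtain ⟨t, ht⟩ := (wordPerm (ts.flatMap F)).surjective (i (Fin.last k))
    have htq (l : ℕ) (hl : l < k) : (t : ℕ) ≠ q k l := fun h =>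
      (Fin.castSucc_lt_last ⟨l, hl⟩).ne (i.injective ((hts ⟨l, hl⟩ t h).symm.trans ht))
    refine ⟨ts ++ [t], by simp [hlen], fun l p hp => ?_⟩
    rw [List.flatMap_append, wordPerm_append, Equiv.Perm.mul_apply, List.flatMap_singleton]
    induction l using Fin.lastCases with
    | last => rw [hlast k t p htq hp, ht]
    | cast l => exact hts l _ (hcast k t p htq l l.2 hp)

theorem exists_wordPerm_flatMap_frontWord {k : ℕ} (i : Fin k ↪ Fin n) :
    ∃ ts : List (Fin n), ts.length = k ∧ ∀ (l : Fin k) (p : Fin n), (p : ℕ) = k - 1 - (l : ℕ) →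
      wordPerm (ts.flatMap frontWord) p = i l := by
  have hge {k : ℕ} {t : Fin n} (ht : ∀ l < k, (t : ℕ) ≠ k - 1 - l) : k ≤ t := by
    have := ht (k - 1 - t)
    omega
  refine exists_wordPerm_flatMap (q := fun k l => k - 1 - l) (fun _ t p _ hp => Fin.ext ?_)
    (fun k t p ht l hl hp => ?_) i
  · rw [wordPerm_frontWord_val, if_pos (by omega)]
  · have := hge ht
    rw [wordPerm_frontWord_val, if_neg (by omega), if_pos (by omega)]
    omega

theorem exists_wordPerm_flatMap_backWord {k : ℕ} (i : Fin k ↪ Fin n) :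
    ∃ ts : List (Fin n), ts.length = k ∧ ∀ (l : Fin k) (p : Fin n), (p : ℕ) = n - k + l →
      wordPerm (ts.flatMap backWord) p = i l := by
  have hlt {k : ℕ} {t : Fin n} (ht : ∀ l < k, (t : ℕ) ≠ n - k + l) : t + k < n := by
    have := ht (t - (n - k))
    omega
  refine exists_wordPerm_flatMap (q := fun k l => n - k + l) (fun k t p ht hp => Fin.ext ?_)
    (fun k t p ht l hl hp => ?_) i
  · have := hlt ht
    rw [wordPerm_backWord_val, if_pos (by omega)]
  · have := hlt ht
    rw [wordPerm_backWord_val, if_neg (by omega), if_pos (by omega)]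
    omega

theorem length_flatMap_le_mul {α β : Type*} {f : α → List β} {m : ℕ}
    (hf : ∀ a, (f a).length ≤ m) (l : List α) : (l.flatMap f).length ≤ l.length * m := by
  rw [List.length_flatMap]
  simpa using List.sum_le_card_nsmul (l.map fun a => (f a).length) m (by simp [hf])

theorem length_frontWord_le (t : Fin n) : (frontWord t).length ≤ n := by
  rw [frontWord, List.length_reverse, List.length_ofFn]
  exact t.is_le'

theorem length_backWord_le (t : Fin n) : (backWord t).length ≤ n := by
  rw [backWord, List.length_ofFn]
  omega

variable {V : Fin (n - 1) → Circuit (LehmerWire n)}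

theorem wordCircuit_cons (s : Fin (n - 1)) (w : List (Fin (n - 1))) :
    wordCircuit V (s :: w) = V s ++ wordCircuit V w := rfl

theorem implementsReorder_wordCircuit (hV : ∀ s, ImplementsReorder (V s) (adjSwap s))
    (w : List (Fin (n - 1))) : ImplementsReorder (wordCircuit V w) (wordPerm w) := by
  induction w with
  | nil => exact fun σ => Matrix.one_mulVec _
  | cons s w ih =>
    intro σ
    rw [wordCircuit_cons, Circuit.mat_append, ← Matrix.mulVec_mulVec, hV s, ih, wordPerm_cons,
      mul_assoc]

theorem depth_wordCircuit_le {d : ℕ} (hV : ∀ s, (V s).depth ≤ d) (w : List (Fin (n - 1))) :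
    (wordCircuit V w).depth ≤ w.length * d :=
  length_flatMap_le_mul hV w

end Words

/-! ### Depth bounds -/

section Depth

variable {n k : ℕ}

theorem clog_two_le_four_mul_log (hn : 2 ≤ n) : (Nat.clog 2 n : ℝ) ≤ 4 * Real.log n := by
  have hlog : Real.log 2 ≤ Real.log n := Real.log_le_log two_pos (by exact_mod_cast hn)
  have hlog2 := Real.log_two_gt_d9
  have hlogb : 1 ≤ Real.logb 2 n := (one_le_div (by positivity)).2 hlog
  calc (Nat.clog 2 n : ℝ) = ⌈Real.logb 2 n⌉₊ := by
        exact_mod_cast (Real.natCeil_logb_natCast 2 n).symm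
    _ ≤ Real.logb 2 n + 1 := (Nat.ceil_lt_add_one (by positivity)).le
    _ ≤ 2 * Real.logb 2 n := by linarith
    _ ≤ 4 * Real.log n := by
      rw [← Real.log_div_log, mul_div_assoc', div_le_iff₀ (by positivity)]
      nlinarith

theorem two_pow_clog_two_lt (hn : 2 ≤ n) : 2 ^ Nat.clog 2 n < 2 * n := by
  have hpos : 1 ≤ Nat.clog 2 n := Nat.clog_pos one_lt_two hn
  have hlt : 2 ^ (Nat.clog 2 n - 1) < n := Nat.pow_pred_clog_lt_self one_lt_two (by omega)
  rw [← Nat.sub_add_cancel hpos, pow_succ]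
  omega

theorem cube_le_four_mul_two_pow (m : ℕ) : m ^ 3 ≤ 4 * 2 ^ m := by
  rcases lt_or_ge m 4 with h | h
  · interval_cases m <;> norm_num
  · induction m, h using Nat.le_induction with
    | base => norm_num
    | succ m hm ih =>
      calc (m + 1) ^ 3 ≤ 2 * m ^ 3 := by nlinarith [Nat.mul_le_mul_right (m ^ 2) hm]
        _ ≤ 4 * 2 ^ (m + 1) := by rw [pow_succ 2]; omega

theorem cast_le_of_le_clog_two_add_one_pow_four {d : ℕ} (hn : 2 ≤ n)
    (hd : d ≤ 4000 * (Nat.clog 2 n + 1) ^ 4) : (d : ℝ) ≤ 2048000 * n * Real.log n := by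
  have hpos := Nat.clog_pos one_lt_two hn
  have hcube : Nat.clog 2 n ^ 3 ≤ 8 * n := by
    have := two_pow_clog_two_lt hn
    have := cube_le_four_mul_two_pow (Nat.clog 2 n)
    omega
  have hfour : d ≤ 512000 * n * Nat.clog 2 n :=
    calc d ≤ 4000 * (Nat.clog 2 n + 1) ^ 4 := hd
      _ ≤ 4000 * (2 * Nat.clog 2 n) ^ 4 := by gcongr; omega
      _ = 64000 * Nat.clog 2 n ^ 3 * Nat.clog 2 n := by ring
      _ ≤ 64000 * (8 * n) * Nat.clog 2 n := by gcongr
      _ = 512000 * n * Nat.clog 2 n := by ring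
  calc (d : ℝ) ≤ 512000 * n * Nat.clog 2 n := by exact_mod_cast hfour
    _ ≤ 512000 * n * (4 * Real.log n) := by gcongr; exact clog_two_le_four_mul_log hn
    _ = 2048000 * n * Real.log n := by ring

theorem cast_le_of_le_mul_clog_two_add_one_sq {c d : ℕ} (hn : 2 ≤ n) (hk : 1 ≤ k)
    (hc : c ≤ 2 * k) (hd : d ≤ 156 * (c * Nat.clog 2 n + 1) ^ 2) :
    (d : ℝ) ≤ 4096000 * (k : ℝ) ^ 2 * Real.log n ^ 2 := by
  have hpos := Nat.clog_pos one_lt_two hn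
  have hle : c * Nat.clog 2 n + 1 ≤ 3 * k * Nat.clog 2 n := by nlinarith
  calc (d : ℝ) ≤ 156 * (3 * k * Nat.clog 2 n) ^ 2 := by
        exact_mod_cast hd.trans (Nat.mul_le_mul_left 156 (Nat.pow_le_pow_left hle 2))
    _ ≤ 156 * (3 * k * (4 * Real.log n)) ^ 2 := by gcongr; exact clog_two_le_four_mul_log hn
    _ = 22464 * ((k : ℝ) ^ 2 * Real.log n ^ 2) := by ring
    _ ≤ 4096000 * ((k : ℝ) ^ 2 * Real.log n ^ 2) := by gcongr; norm_num
    _ = 4096000 * (k : ℝ) ^ 2 * Real.log n ^ 2 := by ring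

theorem depth_wordCircuit_le_mul_log {V : Fin (n - 1) → Circuit (LehmerWire n)} {m : ℕ}
    (hn : 2 ≤ n) (hV : ∀ s, (V s).depth ≤ 4000 * (Nat.clog 2 n + 1) ^ 4)
    {w : List (Fin (n - 1))} (hw : w.length ≤ m * n) (hm : m ≤ 2 * k) :
    ((wordCircuit V w).depth : ℝ) ≤ 4096000 * k * (n : ℝ) ^ 2 * Real.log n := by
  have hlen : w.length ≤ 2 * k * n := hw.trans (Nat.mul_le_mul_right n hm)
  calc ((wordCircuit V w).depth : ℝ)
      ≤ w.length * (4000 * (Nat.clog 2 n + 1) ^ 4 : ℕ) := by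
        exact_mod_cast depth_wordCircuit_le hV w
    _ ≤ (2 * k * n : ℕ) * (2048000 * n * Real.log n) := by
      gcongr
      exact cast_le_of_le_clog_two_add_one_pow_four hn le_rfl
    _ = 4096000 * k * (n : ℝ) ^ 2 * Real.log n := by push_cast; ring

end Depth

/-! ### Partial assignments and partial rankings -/

section Constraints

variable {n k : ℕ} {π ρ : Equiv.Perm (Fin n)}

theorem partialAssignment_iff_lehmer {i : Fin k ↪ Fin n} {j : Fin k → Fin n}
    (hπ : ∀ (l : Fin k) (p : Fin n), (p : ℕ) = k - 1 - (l : ℕ) → π p = i l)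
    (hρ : PartialAssignment i j ρ) (σ : Equiv.Perm (Fin n)) :
    PartialAssignment i j σ ↔
      ∀ p : Fin n, (p : ℕ) < k → lehmer (σ * π) p = lehmer (ρ * π) p := by
  have hkn : k ≤ n := by simpa using Fintype.card_le_of_embedding i
  rw [forall_lehmer_eq_iff]
  constructor
  · intro hσ p hp
    have hpi : π p = i ⟨k - 1 - p, by omega⟩ := hπ _ p (by simp only; omega)
    rw [Equiv.Perm.mul_apply, Equiv.Perm.mul_apply, hpi, hσ, hρ]
  · intro h l
    have hpi := hπ l ⟨k - 1 - l, by omega⟩ rfl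
    have heq := h ⟨k - 1 - l, by omega⟩ (by simp only; omega)
    rwa [Equiv.Perm.mul_apply, Equiv.Perm.mul_apply, hpi, hρ] at heq

theorem lehmer_revPerm (p : Fin n) : lehmer Fin.revPerm p = n - 1 - p :=
  lehmer_eq_max_iff.2 fun _ => Fin.rev_lt_rev.2

theorem partialRanking_iff_lehmer {i : Fin (k + 1) ↪ Fin n}
    (hπ : ∀ (l : Fin (k + 1)) (p : Fin n), (p : ℕ) = n - 1 - k + (l : ℕ) → π p = i l)
    (σ : Equiv.Perm (Fin n)) :
    PartialRanking i σ ↔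
      ∀ p : Fin n, n - 1 - k ≤ (p : ℕ) → lehmer (σ * π) p = lehmer Fin.revPerm p := by
  have hkn : k + 1 ≤ n := by simpa using Fintype.card_le_of_embedding i
  have hanti : PartialRanking i σ ↔ StrictAnti fun l => σ (i l) :=
    (Fin.strictAnti_iff_succ_lt (f := fun l => σ (i l))).symm
  simp only [hanti, lehmer_revPerm, lehmer_eq_max_iff, Equiv.Perm.mul_apply]
  constructor
  · intro h p hp p' hpp'
    have := Fin.lt_def.1 hpp'
    rw [hπ ⟨p - (n - 1 - k), by omega⟩ p (by simp only; omega),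
      hπ ⟨p' - (n - 1 - k), by omega⟩ p' (by simp only; omega)]
    exact h (Fin.lt_def.2 (by simp only; omega))
  · intro h l l' hll'
    have := Fin.lt_def.1 hll'
    have hlt := h ⟨n - 1 - k + l, by omega⟩ (Nat.le_add_right _ _) ⟨n - 1 - k + l', by omega⟩
      (Fin.lt_def.2 (by simp only; omega))
    rwa [hπ l' _ rfl, hπ l _ rfl] at hlt

theorem exists_computesAfterReorder_partialAssignment (hn : 2 ≤ n) (hk : 1 ≤ k)
    {i : Fin k ↪ Fin n} (j : Fin k → Fin n)
    (hπ : ∀ (l : Fin k) (p : Fin n), (p : ℕ) = k - 1 - (l : ℕ) → π p = i l) :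
    ∃ Q : Circuit (Option (LehmerWire n)),
      Q.ActsOn {o | ∀ v, o = some v → (v.1 : ℕ) < k} ∧
      ComputesAfterReorder Q π (PartialAssignment i j) ∧
      (Q.depth : ℝ) ≤ 4096000 * (k : ℝ) ^ 2 * Real.log n ^ 2 := by
  by_cases hex : ∃ ρ, PartialAssignment i j ρ
  · obtain ⟨ρ, hρ⟩ := hex
    obtain ⟨Q, hQR, hQ, hQd⟩ :=
      exists_computesAfterReorder (I := {p : Fin n | (p : ℕ) < k}) (π := π) (ρ := ρ * π) fun σ =>
        (partialAssignment_iff_lehmer hπ hρ σ).trans (by simp only [Finset.mem_filter_univ])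
    have hcard : Finset.card {p : Fin n | (p : ℕ) < k} ≤ 2 * k := by
      rw [Fin.card_filter_val_lt]
      omega
    exact ⟨Q, by simpa only [Finset.mem_filter_univ] using hQR, hQ,
      cast_le_of_le_mul_clog_two_add_one_sq hn hk hcard hQd⟩
  · refine ⟨[], by simp [Circuit.ActsOn], fun σ b => ?_, ?_⟩
    · have hφ : ¬ PartialAssignment i j σ := fun hσ => hex ⟨σ, hσ⟩
      simp [Circuit.mat, hφ]
    · simp only [Circuit.depth, List.length_nil, Nat.cast_zero]
      positivity

theorem exists_computesAfterReorder_partialRanking (hn : 2 ≤ n) (hk : 1 ≤ k)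
    {i : Fin (k + 1) ↪ Fin n}
    (hπ : ∀ (l : Fin (k + 1)) (p : Fin n), (p : ℕ) = n - 1 - k + (l : ℕ) → π p = i l) :
    ∃ Q : Circuit (Option (LehmerWire n)),
      Q.ActsOn {o | ∀ v, o = some v → n - 1 - k ≤ (v.1 : ℕ)} ∧
      ComputesAfterReorder Q π (PartialRanking i) ∧
      (Q.depth : ℝ) ≤ 4096000 * (k : ℝ) ^ 2 * Real.log n ^ 2 := by
  obtain ⟨Q, hQR, hQ, hQd⟩ :=
    exists_computesAfterReorder (I := {p : Fin n | n - 1 - k ≤ (p : ℕ)}) (π := π)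
      (ρ := Fin.revPerm) fun σ =>
        (partialRanking_iff_lehmer hπ σ).trans (by simp only [Finset.mem_filter_univ])
  have hcard : Finset.card {p : Fin n | n - 1 - k ≤ (p : ℕ)} ≤ 2 * k := by
    have hle := Finset.card_le_card_of_injOn (s := {p : Fin n | n - 1 - k ≤ (p : ℕ)})
      (t := Finset.Ico (n - 1 - k) n) Fin.val (fun p hp => by simpa using hp)
      Fin.val_injective.injOn
    rw [Nat.card_Ico] at hle
    omega
  exact ⟨Q, by simpa only [Finset.mem_filter_univ] using hQR, hQ,
    cast_le_of_le_mul_clog_two_add_one_sq hn hk hcard hQd⟩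

end Constraints

end

theorem mainTheorem6 :
    ∃ C : ℝ, 0 < C ∧ ∀ n : ℕ, 2 ≤ n →
      -- local, ancilla-free circuits for the adjacent-transposition updates
      ∃ V : Fin (n - 1) → Circuit (LehmerWire n),
        (∀ s : Fin (n - 1),
          Circuit.ActsOn (V s)
            {w | (w.1 : ℕ) = (s : ℕ) ∨ (w.1 : ℕ) = (s : ℕ) + 1} ∧
          ImplementsReorder (V s) (adjSwap s) ∧
          (Circuit.depth (V s) : ℝ) ≤ C * (n : ℝ) * Real.log n) ∧
        -- partial assignments of order `k`: the indices are brought to the beginning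
        (∀ (k : ℕ), 1 ≤ k → ∀ i : Fin k ↪ Fin n,
          ∃ (ts : List (Fin n)) (w : List (Fin (n - 1))) (π : Equiv.Perm (Fin n)),
            ts.length = k ∧ w = ts.flatMap frontWord ∧ π = wordPerm w ∧
            (∀ (l : Fin k) (p : Fin n), (p : ℕ) = k - 1 - (l : ℕ) → π p = i l) ∧
            w.length ≤ k * n ∧
            ImplementsReorder (wordCircuit V w) π ∧
            (Circuit.depth (wordCircuit V w) : ℝ) ≤ C * (k : ℝ) * (n : ℝ) ^ 2 * Real.log n ∧
            ∀ j : Fin k → Fin n, ∃ Q : Circuit (Option (LehmerWire n)),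
              Circuit.ActsOn Q {o | ∀ v, o = some v → (v.1 : ℕ) < k} ∧
              ComputesAfterReorder Q π (PartialAssignment i j) ∧
              (Circuit.depth Q : ℝ) ≤ C * (k : ℝ) ^ 2 * (Real.log n) ^ 2) ∧
        -- partial rankings of order `k` (`k + 1` indices): the indices are brought to the end
        (∀ (k : ℕ) (i : Fin (k + 1) ↪ Fin n),
          ∃ (ts : List (Fin n)) (w : List (Fin (n - 1))) (π : Equiv.Perm (Fin n)),
            ts.length = k + 1 ∧ w = ts.flatMap backWord ∧ π = wordPerm w ∧
            (∀ (l : Fin (k + 1)) (p : Fin n),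
              (p : ℕ) = n - 1 - k + (l : ℕ) → π p = i l) ∧
            w.length ≤ (k + 1) * n ∧
            ImplementsReorder (wordCircuit V w) π ∧
            (1 ≤ k →
              (Circuit.depth (wordCircuit V w) : ℝ) ≤ C * (k : ℝ) * (n : ℝ) ^ 2 * Real.log n ∧
              ∃ Q : Circuit (Option (LehmerWire n)),
                Circuit.ActsOn Q {o | ∀ v, o = some v → n - 1 - k ≤ (v.1 : ℕ)} ∧
                ComputesAfterReorder Q π (PartialRanking i) ∧
                (Circuit.depth Q : ℝ) ≤ C * (k : ℝ) ^ 2 * (Real.log n) ^ 2)) := by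
  refine ⟨4096000, by norm_num, fun n hn => ?_⟩
  choose V hVR hV hVd using exists_implementsReorder_adjSwap (n := n)
  refine ⟨V, fun s => ⟨hVR s, hV s, ?_⟩, fun k hk i => ?_, fun k i => ?_⟩
  · exact (cast_le_of_le_clog_two_add_one_pow_four hn (hVd s)).trans (by gcongr; norm_num)
  · obtain ⟨ts, hlen, hts⟩ := exists_wordPerm_flatMap_frontWord i
    have hw : (ts.flatMap frontWord).length ≤ k * n :=
      hlen ▸ length_flatMap_le_mul length_frontWord_le ts
    exact ⟨ts, _, _, hlen, rfl, rfl, hts, hw, implementsReorder_wordCircuit hV _,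
      depth_wordCircuit_le_mul_log hn hVd hw (by omega),
      fun j => exists_computesAfterReorder_partialAssignment hn hk j hts⟩
  · obtain ⟨ts, hlen, hts⟩ := exists_wordPerm_flatMap_backWord i
    have hπ (l : Fin (k + 1)) (p : Fin n) (hp : (p : ℕ) = n - 1 - k + l) :
        wordPerm (ts.flatMap backWord) p = i l := hts l p (by omega)
    have hw : (ts.flatMap backWord).length ≤ (k + 1) * n :=
      hlen ▸ length_flatMap_le_mul length_backWord_le ts
    exact ⟨ts, _, _, hlen, rfl, rfl, hπ, hw, implementsReorder_wordCircuit hV _, fun hk =>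
      ⟨depth_wordCircuit_le_mul_log hn hVd hw (by omega),
        exists_computesAfterReorder_partialRanking hn hk hπ⟩⟩
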